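/- For integers $a,b,c\ge 1$ with $b$ odd let $$F_{a,b,c}(z)=\frac{\eta(24az)^a\,\eta(24acz)^{b-a}}{\eta(24z)}\qquad(\operatorname{Im} z>0),$$ where $\eta(z)=q^{1/24}\prod_{n\ge1}(1-q^n)$, $q=e^{2\pi i z}$, is the Dedekind eta function. Put $k=\frac{b-1}{2}$ and $N=576ac$. Then $F_{a,b,c}$ is a weakly holomorphic modular form (holomorphic on the upper half-plane and meromorphic at all cusps) of weight $k$ on $\Gamma_0(N)$ with Nebentypus character $\chi_F$, the Dirichlet character modulo $N$ given for integers $d$ coprime to $N$ by the Kronecker symbol $$\chi_F(d)=\begin{cases}\left(\dfrac{(-1)^k ac}{d}\right)&\text{if } a \text{ is even},\\[2mm] \left(\dfrac{(-1)^k a}{d}\right)&\text{if } a \text{ is odd}.\end{cases}$$ Furthermore, $F_{a,b,c}$ is a holomorphic modular form (that is, $F_{a,b,c}\in M_k(\Gamma_0(N),\chi_F)$) if and only if $b\ge a$, and a cusp form (that is, $F_{a,b,c}\in S_k(\Gamma_0(N),\chi_F)$) if and only if $b>a$. -/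

import Mathlib

open UpperHalfPlane CongruenceSubgroup
open scoped MatrixGroups ModularForm Manifold

namespace EtaQuotient

/-- The Kronecker symbol `(n / d)` for arbitrary integers `n` and `d`: completely multiplicative
in `d`, equal to the Jacobi symbol for odd `d > 0`, with `(n / -1) = -1` exactly when `n < 0`,
with `(n / 2) = 0, 1, -1` according as `n` is even, `n ≡ ±1 mod 8`, `n ≡ ±3 mod 8`, and with
`(n / 0) = 1` if `n = ±1` and `0` otherwise. -/
noncomputable def kroneckerSym (n d : ℤ) : ℤ :=
  if d = 0 then (if n.natAbs = 1 then 1 else 0)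
  else (if n < 0 ∧ d < 0 then -1 else 1)
    * ZMod.χ₈ (n : ZMod 8) ^ padicValNat 2 d.natAbs
    * jacobiSym n (d.natAbs / 2 ^ padicValNat 2 d.natAbs)

/-- `g` has a Laurent expansion `∑_{n ≥ 0} A n * q_h ^ (m + n)` in `q_h = exp (2 π i τ / h)`, for
some width `h ≥ 1` and some `m : ℤ`, i.e. an expansion at `i∞` with only finitely many terms of
negative exponent. -/
def IsMeromorphicAtImInfty (g : ℍ → ℂ) : Prop :=
  ∃ h : ℕ, 0 < h ∧ ∃ (m : ℤ) (A : ℕ → ℂ), ∀ τ : ℍ,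
    HasSum (fun n : ℕ => A n * Function.Periodic.qParam (h : ℝ) (τ : ℂ) ^ (m + (n : ℤ))) (g τ)

/-- `f` is holomorphic on the upper half plane and transforms as
`f ((A τ + B) / (C τ + D)) = χ D * (C τ + D) ^ k * f τ` under `Γ₀(N)`. -/
structure IsHolomorphicNebentypus (N : ℕ) (k : ℤ) (χ : DirichletCharacter ℂ N) (f : ℍ → ℂ) :
    Prop where
  holo : MDiff f
  slash : ∀ γ ∈ Gamma0 N, f ∣[k] γ = χ ((γ 1 1 : ℤ) : ZMod N) • f

/-- Weakly holomorphic modular forms of weight `k` on `Γ₀(N)` with Nebentypus `χ`: meromorphic at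
every cusp. -/
structure IsWeaklyHolomorphicForm (N : ℕ) (k : ℤ) (χ : DirichletCharacter ℂ N) (f : ℍ → ℂ) :
    Prop extends IsHolomorphicNebentypus N k χ f where
  meromorphic_at_cusps : ∀ γ : SL(2, ℤ), IsMeromorphicAtImInfty (f ∣[k] γ)

/-- Holomorphic modular forms, i.e. the elements of `M_k(Γ₀(N), χ)`. -/
structure IsHolomorphicForm (N : ℕ) (k : ℤ) (χ : DirichletCharacter ℂ N) (f : ℍ → ℂ) :
    Prop extends IsHolomorphicNebentypus N k χ f where
  bounded_at_cusps : ∀ γ : SL(2, ℤ), IsBoundedAtImInfty (f ∣[k] γ)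

/-- Cusp forms, i.e. the elements of `S_k(Γ₀(N), χ)`. -/
structure IsCuspidalForm (N : ℕ) (k : ℤ) (χ : DirichletCharacter ℂ N) (f : ℍ → ℂ) :
    Prop extends IsHolomorphicNebentypus N k χ f where
  zero_at_cusps : ∀ γ : SL(2, ℤ), IsZeroAtImInfty (f ∣[k] γ)

/-- The eta quotient `F_{a,b,c}(τ) = η(24aτ)^a η(24acτ)^(b-a) / η(24τ)`; the exponent `b - a` is an
integer that may be negative. -/
noncomputable def F (a b c : ℕ) (τ : ℍ) : ℂ :=
  ModularForm.eta (24 * a * τ) ^ a * ModularForm.eta (24 * a * c * τ) ^ ((b : ℤ) - (a : ℤ))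
    / ModularForm.eta (24 * τ)

end EtaQuotient

/-!
The character and the orders at the cusps are computed separately.

*Transformation law.* Conjugating by `diag(24, 1)` reduces the claim to the behaviour of `η(n τ)`,
`n ∣ a c`, under matrices with both off-diagonal entries divisible by `24`. Up to squares, the eta
quotient is `η(n τ) / η(τ)` with `n = a c` for even `a` and `n = a` for odd `a`. The squares are
governed by `eta_sq_moebius`: the multiplier of `η ^ 2` is an explicit polynomial in the matrix
entries modulo `12`, checked on the generators `S` and `T`, and on the matrices at hand it is the
nontrivial character modulo `4`. For the quotient `η(p τ) / η(τ)` with `p` an odd prime,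
`eta_mul_eq_prod_klein` writes `η(p τ)` as a constant times `η(τ) ^ p` times the product of the
Klein forms `klein (2 j / p) τ` over a half-system of residues modulo `p`. A matrix with lower right
entry `d` and lower left entry divisible by `24 p` multiplies these torsion points by `d`, up to
roots of unity that cancel in the product. Since the Klein form is odd, Gauss's lemma turns the
resulting permutation with signs into the Legendre symbol of `d` modulo `p` (`prod_odd_function`).
The point of order four plays this role for the prime `2`, and induction on the prime factors of `n`
gives the Jacobi symbol (`eta_mul_nat_moebius`).

The transformation law of the Klein form under all of `SL(2, ℤ)` (`klein_moebius`) follows from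
uniqueness: an entire function of `u` with the quasi-periodicity of a degree-one theta function is
determined by one Fourier coefficient (`eq_mul_klein_of_quasiperiodic`).

*Cusps.* Writing `(δ A, δ B; C, D)` as an element of `SL(2, ℤ)` times an upper triangular matrix
shows that `η(δ γ τ)` has order proportional to `gcd(C, δ) ^ 2 / δ` at the cusp `γ ∞`. Hence
`‖(F ∣ γ) τ‖ ^ 2 exp(o Im τ)` has a positive limit (`tendsto_norm_slash_F`), where, up to a positive
factor, `o` is

  `gcd(C, 24 a) ^ 2 - gcd(C, 24) ^ 2 + (b - a) gcd(C, 24 a c) ^ 2 / (a c)`.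

The first two terms have nonnegative sum, and they cancel at the cusp `0`, where `C = 1`. So the sign
of `b - a` decides whether `F` is bounded, or vanishes, at all cusps.
-/

open Complex (exp)

namespace EtaQuotient

/-! ### The Klein form as a `q`-product -/

/-- The nome `exp (2 π i z)`. -/
noncomputable def nome (z : ℂ) : ℂ := exp (2 * Real.pi * Complex.I * z)

lemma nome_add (z w : ℂ) : nome (z + w) = nome z * nome w := by
  simp only [nome, mul_add, Complex.exp_add]

lemma nome_sub (z w : ℂ) : nome (z - w) = nome z / nome w := by
  simp only [nome, mul_sub, Complex.exp_sub]

lemma nome_neg (z : ℂ) : nome (-z) = (nome z)⁻¹ := by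
  simp only [nome, mul_neg, Complex.exp_neg]

@[simp] lemma nome_zero : nome 0 = 1 := by simp [nome]

@[simp] lemma nome_ne_zero (z : ℂ) : nome z ≠ 0 := Complex.exp_ne_zero _

@[simp] lemma nome_int (n : ℤ) : nome n = 1 := by
  rw [nome, mul_comm]
  exact Complex.exp_int_mul_two_pi_mul_I n

@[simp] lemma nome_one : nome 1 = 1 := by simpa using nome_int 1

@[simp] lemma nome_half : nome (1 / 2) = -1 := by
  rw [nome, show 2 * (Real.pi : ℂ) * Complex.I * (1 / 2) = Real.pi * Complex.I by ring,
    Complex.exp_pi_mul_I]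

lemma nome_nat_mul (n : ℕ) (z : ℂ) : nome (n * z) = nome z ^ n := by
  rw [nome, nome, ← Complex.exp_nat_mul]
  ring_nf

lemma nome_int_mul (n : ℤ) (z : ℂ) : nome (n * z) = nome z ^ n := by
  rw [nome, nome, ← Complex.exp_int_mul]
  ring_nf

lemma nome_int_half (n : ℤ) : nome (n / 2) = (-1) ^ n := by
  rw [div_eq_mul_one_div, nome_int_mul, nome_half]

lemma nome_add_int (z : ℂ) (n : ℤ) : nome (z + n) = nome z := by
  rw [nome_add, nome_int, mul_one]

lemma nome_add_one (z : ℂ) : nome (z + 1) = nome z := by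
  rw [nome_add, nome_one, mul_one]

lemma nome_eq_qParam (z : ℂ) : nome z = Function.Periodic.qParam 1 z := by
  simp [nome, Function.Periodic.qParam]

lemma norm_nome (z : ℂ) : ‖nome z‖ = Real.exp (-2 * Real.pi * z.im) := by
  rw [nome_eq_qParam, Function.Periodic.norm_qParam]
  simp

lemma norm_nome_lt_one {τ : ℂ} (hτ : 0 < τ.im) : ‖nome τ‖ < 1 := by
  rw [norm_nome, Real.exp_lt_one_iff]
  have := mul_pos Real.pi_pos hτ
  linarith

lemma differentiable_nome : Differentiable ℂ nome := by
  unfold nome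
  fun_prop

@[fun_prop]
lemma Differentiable.nome {f : ℂ → ℂ} (hf : Differentiable ℂ f) :
    Differentiable ℂ fun z ↦ nome (f z) :=
  differentiable_nome.comp hf

/-- The infinite `q`-Pochhammer symbol `∏_{n ≥ 0} (1 - x q ^ n)`. -/
noncomputable def qPoch (x q : ℂ) : ℂ := ∏' n : ℕ, (1 - x * q ^ n)

lemma multipliable_qPoch (x : ℂ) {q : ℂ} (hq : ‖q‖ < 1) :
    Multipliable fun n : ℕ ↦ 1 - x * q ^ n := by
  simp_rw [sub_eq_add_neg]
  apply multipliable_one_add_of_summable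
  simpa using (summable_geometric_of_lt_one (norm_nonneg _) hq).mul_left ‖x‖

lemma qPoch_eq_mul (x : ℂ) {q : ℂ} (hq : ‖q‖ < 1) :
    qPoch x q = (1 - x) * qPoch (x * q) q := by
  have h : ∀ n : ℕ, 1 - x * q ^ (n + 1) = 1 - x * q * q ^ n := fun n ↦ by ring
  rw [qPoch, tprod_eq_zero_mul' (by simpa only [h] using multipliable_qPoch (x * q) hq)]
  simp only [h, pow_zero, mul_one, qPoch]

lemma differentiable_qPoch {q : ℂ} (hq : ‖q‖ < 1) : Differentiable ℂ fun x ↦ qPoch x q := by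
  intro x₀
  have hU : IsOpen (Metric.ball (0 : ℂ) (‖x₀‖ + 1)) := Metric.isOpen_ball
  have hx : x₀ ∈ Metric.ball (0 : ℂ) (‖x₀‖ + 1) := by simp
  have := Summable.hasProdLocallyUniformlyOn_nat_one_add (f := fun n (x : ℂ) ↦ -(x * q ^ n)) hU
    ((summable_geometric_of_lt_one (norm_nonneg _) hq).mul_left (‖x₀‖ + 1))
    (.of_forall fun n x hx ↦ by
      rw [norm_neg, norm_mul, norm_pow]
      gcongr
      exact (mem_ball_zero_iff.mp hx).le)
    (fun n ↦ by fun_prop)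
  have h2 := this.differentiableOn (.of_forall fun s ↦ by
    simpa [Finset.prod_fn] using DifferentiableOn.finsetProd (fun _ _ ↦ by fun_prop)) hU
  simpa only [qPoch, sub_eq_add_neg] using (h2.differentiableAt (hU.mem_nhds hx))

lemma qPoch_nome_ne_zero {τ : ℂ} (hτ : 0 < τ.im) : qPoch (nome τ) (nome τ) ≠ 0 := by
  have := ModularForm.eta_tprod_ne_zero (z := τ) hτ
  simpa only [qPoch, nome_eq_qParam, ModularForm.eta_q, pow_succ'] using this

lemma eta_eq (τ : ℂ) : ModularForm.eta τ = nome (τ / 24) * qPoch (nome τ) (nome τ) := by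
  simp only [ModularForm.eta, qPoch, nome_eq_qParam, ModularForm.eta_q, pow_succ']
  congr 1
  simp only [Function.Periodic.qParam]
  congr 1
  push_cast
  ring

/-- The Klein form, a multiple of the theta quotient `θ₁(u, τ) / η(τ) ^ 3`. With `q = nome τ` and
`ζ = nome u` it is `(ζ ^ (1/2) - ζ ^ (-1/2)) ∏_{n ≥ 1} (1 - q ^ n ζ) (1 - q ^ n / ζ) / (1 - q ^ n) ^ 2`,
so that it is `2 π i u + O(u ^ 2)` at `u = 0`. -/
noncomputable def klein (u τ : ℂ) : ℂ :=
  (nome (u / 2) - nome (-u / 2)) *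
    (qPoch (nome (u + τ)) (nome τ) * qPoch (nome (-u + τ)) (nome τ)) /
      qPoch (nome τ) (nome τ) ^ 2

lemma klein_neg (u τ : ℂ) : klein (-u) τ = -klein u τ := by
  simp only [klein, neg_neg]
  ring

lemma klein_add_one (u τ : ℂ) : klein (u + 1) τ = -klein u τ := by
  have h1 : nome ((u + 1) / 2) = -nome (u / 2) := by
    rw [add_div, nome_add, nome_half]; ring
  have h2 : nome (-(u + 1) / 2) = -nome (-u / 2) := by
    rw [show -(u + 1) / 2 = -u / 2 - 1 / 2 by ring, nome_sub, nome_half]; ring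
  have h3 : nome (u + 1 + τ) = nome (u + τ) := by
    rw [add_right_comm, nome_add_one]
  have h4 : nome (-(u + 1) + τ) = nome (-u + τ) := by
    rw [← nome_add_one (-(u + 1) + τ)]; ring_nf
  simp only [klein, h1, h2, h3, h4]
  ring

lemma klein_add_tau (u : ℂ) {τ : ℂ} (hτ : 0 < τ.im) :
    klein (u + τ) τ = -nome (-τ / 2 - u) * klein u τ := by
  have hq := norm_nome_lt_one hτ
  have h1 : qPoch (nome (u + τ)) (nome τ) =
      (1 - nome (u + τ)) * qPoch (nome (u + τ + τ)) (nome τ) := by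
    rw [qPoch_eq_mul _ hq, ← nome_add]
  have h2 : qPoch (nome (-(u + τ) + τ)) (nome τ) =
      (1 - nome (-u)) * qPoch (nome (-u + τ)) (nome τ) := by
    rw [qPoch_eq_mul _ hq, ← nome_add, show -(u + τ) + τ = -u by ring]
  -- the prefactors agree because `nome` turns both sides into the same Laurent monomials
  have h3 : (nome ((u + τ) / 2) - nome (-(u + τ) / 2)) * (1 - nome (-u)) =
      -nome (-τ / 2 - u) * ((nome (u / 2) - nome (-u / 2)) * (1 - nome (u + τ))) := by
    simp only [sub_mul, mul_sub, mul_one, neg_mul, ← nome_add]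
    ring_nf
  simp only [klein, h1, h2]
  rw [show ∀ A B C D E : ℂ, A * (B * (C * D)) / E = A * C * (B * D / E) by intros; ring, h3]
  ring

lemma differentiable_klein {τ : ℂ} (hτ : 0 < τ.im) : Differentiable ℂ fun u ↦ klein u τ := by
  have hq := differentiable_qPoch (norm_nome_lt_one hτ)
  have h1 : Differentiable ℂ fun u ↦ qPoch (nome (u + τ)) (nome τ) :=
    hq.comp (f := fun u ↦ nome (u + τ)) (by fun_prop)
  have h2 : Differentiable ℂ fun u ↦ qPoch (nome (-u + τ)) (nome τ) :=
    hq.comp (f := fun u ↦ nome (-u + τ)) (by fun_prop)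
  unfold klein
  fun_prop

@[simp] lemma klein_zero (τ : ℂ) : klein 0 τ = 0 := by simp [klein]

lemma hasDerivAt_klein_zero {τ : ℂ} (hτ : 0 < τ.im) :
    HasDerivAt (fun u ↦ klein u τ) (2 * Real.pi * Complex.I) 0 := by
  have hq := differentiable_qPoch (norm_nome_lt_one hτ)
  have h1 : Differentiable ℂ fun u ↦ qPoch (nome (u + τ)) (nome τ) :=
    hq.comp (f := fun u ↦ nome (u + τ)) (by fun_prop)
  have h2 : Differentiable ℂ fun u ↦ qPoch (nome (-u + τ)) (nome τ) :=
    hq.comp (f := fun u ↦ nome (-u + τ)) (by fun_prop)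
  have h0 : HasDerivAt (fun u ↦ nome (u / 2) - nome (-u / 2)) (2 * Real.pi * Complex.I) 0 := by
    have ha : HasDerivAt (fun u : ℂ ↦ nome (u / 2)) (1 * (2 * Real.pi * Complex.I * (1 / 2))) 0 := by
      simpa [nome] using (((hasDerivAt_id (0 : ℂ)).div_const 2).const_mul
        (2 * Real.pi * Complex.I)).cexp
    have hb : HasDerivAt (fun u : ℂ ↦ nome (-u / 2)) (1 * (2 * Real.pi * Complex.I * (-1 / 2))) 0 := by
      simpa [nome] using (((hasDerivAt_id (0 : ℂ)).neg.div_const 2).const_mul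
        (2 * Real.pi * Complex.I)).cexp
    exact (ha.sub hb).congr_deriv (by ring)
  have h3 := (h0.mul ((h1 0).hasDerivAt.mul (h2 0).hasDerivAt)).div_const
    (qPoch (nome τ) (nome τ) ^ 2)
  have hne := qPoch_nome_ne_zero hτ
  refine h3.congr_deriv ?_
  simp only [zero_div, neg_zero, sub_self, zero_mul, add_zero, zero_add, Pi.mul_apply]
  field_simp

/-! ### Uniqueness of theta functions of degree one -/

lemma integral_add_of_periodic {g : ℂ → ℂ} (hg : Differentiable ℂ g) (h1 : ∀ u, g (u + 1) = g u)
    (w : ℂ) : ∫ x : ℝ in 0..1, g (x + w) = ∫ x : ℝ in 0..1, g x := by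
  have key := Complex.integral_boundary_rect_eq_zero_of_differentiableOn (fun z ↦ g (z + w.re))
    0 (1 + w.im * Complex.I) (by fun_prop)
  simp only [Complex.zero_re, Complex.zero_im, Complex.add_re, Complex.one_re, Complex.mul_re,
    Complex.ofReal_re, Complex.I_re, mul_zero, Complex.ofReal_im, Complex.I_im, mul_one, sub_self,
    add_zero, Complex.add_im, Complex.one_im, Complex.mul_im, zero_add, Complex.ofReal_zero,
    zero_mul, Complex.ofReal_one] at key
  have hv : ∀ y : ℝ, g (1 + y * Complex.I + w.re) = g (y * Complex.I + w.re) := fun y ↦ by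
    rw [← h1 (y * Complex.I + w.re)]; ring_nf
  simp only [hv, add_sub_cancel_right] at key
  have hw : ∀ x : ℝ, (x : ℂ) + w.im * Complex.I + w.re = x + w := fun x ↦ by
    conv_rhs => rw [← Complex.re_add_im w]
    ring
  simp only [hw] at key
  rw [← sub_eq_zero.mp key]
  have hp : Function.Periodic (fun x : ℝ ↦ g x) 1 := fun x ↦ by simpa using h1 x
  have := hp.intervalIntegral_add_eq w.re 0
  rw [zero_add] at this
  rw [← this]
  simpa [add_comm] using intervalIntegral.integral_comp_add_right (a := 0) (b := 1)
    (fun x : ℝ ↦ g x) w.re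

lemma eq_zero_of_fourier_eq_zero {g : ℂ → ℂ} (hg : Differentiable ℂ g)
    (h1 : ∀ u, g (u + 1) = g u)
    (h : ∀ n : ℤ, ∫ x : ℝ in 0..1, nome (-n * x) * g x = 0) : g = 0 := by
  have hp : Function.Periodic (fun x : ℝ ↦ g x) 1 := fun x ↦ by simpa using h1 x
  have hcont : Continuous fun x : ℝ ↦ g x := hg.continuous.comp Complex.continuous_ofReal
  let f : C(AddCircle (1 : ℝ), ℂ) := ⟨hp.lift, continuous_coinduced_dom.mpr hcont⟩
  have hf : ∀ n, fourierCoeff f n = 0 := fun n ↦ by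
    rw [fourierCoeff_eq_intervalIntegral _ n 0, zero_add]
    simp only [div_one, one_smul, smul_eq_mul]
    rw [← h n]
    refine intervalIntegral.integral_congr fun x _ ↦ ?_
    simp only [fourier_coe_apply, nome]
    congr 2
    push_cast
    ring
  have hs : Summable (fourierCoeff f) := by
    rw [show fourierCoeff f = 0 from funext hf]; exact summable_zero
  have hR : ∀ x : ℝ, g x = 0 := fun x ↦ by
    have := has_pointwise_sum_fourier_series_of_summable hs (x : AddCircle (1 : ℝ))
    simp only [hf, zero_smul] at this
    exact this.unique hasSum_zero
  -- an entire function that vanishes on the real line vanishes identically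
  have hA : AnalyticOnNhd ℂ g Set.univ := fun z _ ↦ hg.analyticAt z
  refine hA.eq_of_frequently_eq (z₀ := 0) (g := 0) (fun z _ ↦ analyticAt_const) ?_
  have ht : Filter.Tendsto (fun x : ℝ ↦ (x : ℂ)) (nhdsWithin 0 {0}ᶜ) (nhdsWithin 0 {0}ᶜ) := by
    refine tendsto_nhdsWithin_of_tendsto_nhds_of_eventually_within _ ?_ ?_
    · simpa using (Complex.continuous_ofReal.tendsto 0).mono_left nhdsWithin_le_nhds
    · filter_upwards [self_mem_nhdsWithin] with x hx
      simpa using hx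
  exact ht.frequently (Filter.Eventually.frequently (.of_forall fun x ↦ by simpa using hR x))

/-- An entire function with the quasi-periodicity of the Klein form is determined by a single
Fourier coefficient: translation by `τ` relates each coefficient to the next one. -/
lemma eq_zero_of_quasiperiodic {τ : ℂ} {h : ℂ → ℂ} (hd : Differentiable ℂ h)
    (h1 : ∀ u, h (u + 1) = -h u) (hτ : ∀ u, h (u + τ) = -nome (-τ / 2 - u) * h u)
    (h0 : ∫ x : ℝ in 0..1, nome (x / 2) * h x = 0) : h = 0 := by
  set g : ℂ → ℂ := fun u ↦ nome (u / 2) * h u with hg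
  have hgd : Differentiable ℂ g := by fun_prop
  have hg1 : ∀ u, g (u + 1) = g u := fun u ↦ by
    simp only [hg, h1, add_div, nome_add, nome_half]; ring
  have hgτ : ∀ u, g (u + τ) = -nome (-u) * g u := fun u ↦ by
    simp only [hg, hτ]
    rw [show nome ((u + τ) / 2) * (-nome (-τ / 2 - u) * h u) =
      -(nome ((u + τ) / 2) * nome (-τ / 2 - u)) * h u by ring,
      show -nome (-u) * (nome (u / 2) * h u) = -(nome (-u) * nome (u / 2)) * h u by ring,
      ← nome_add, ← nome_add]
    ring_nf
  set a : ℤ → ℂ := fun n ↦ ∫ x : ℝ in 0..1, nome (-n * x) * g x with ha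
  have hrec : ∀ n : ℤ, a n = -nome (-n * τ) * a (n + 1) := fun n ↦ by
    have := integral_add_of_periodic (g := fun u ↦ nome (-n * u) * g u) (by fun_prop)
      (fun u ↦ by
        rw [hg1, mul_add, mul_one, ← Int.cast_neg, nome_add_int]) τ
    simp only [ha]
    rw [← this, ← intervalIntegral.integral_const_mul]
    refine intervalIntegral.integral_congr fun x _ ↦ ?_
    simp only [hgτ]
    rw [show nome (-n * (x + τ)) * (-nome (-x) * g x) =
      -(nome (-n * (x + τ)) * nome (-x)) * g x by ring, ← nome_add,
      show -nome (-n * τ) * (nome (-((n + 1 : ℤ) : ℂ) * x) * g x) =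
      -(nome (-n * τ) * nome (-((n + 1 : ℤ) : ℂ) * x)) * g x by ring, ← nome_add]
    push_cast
    ring_nf
  have hall : ∀ n, a n = 0 := fun n ↦ by
    induction n using Int.induction_on with
    | zero => simpa [ha] using h0
    | succ n ih =>
      have := hrec n
      rw [ih] at this
      simpa using this.symm
    | pred n ih => rw [hrec, sub_add_cancel, ih, mul_zero]
  have hg0 := eq_zero_of_fourier_eq_zero hgd hg1 hall
  funext u
  simpa [hg] using congrFun hg0 u

/-- The space of theta functions of degree one is spanned by the Klein form; the multiple is read
off from the derivative at the origin. -/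
lemma eq_mul_klein_of_quasiperiodic {τ : ℂ} (him : 0 < τ.im) {h : ℂ → ℂ} (hd : Differentiable ℂ h)
    (h1 : ∀ u, h (u + 1) = -h u) (hτ : ∀ u, h (u + τ) = -nome (-τ / 2 - u) * h u)
    {c : ℂ} (hc : HasDerivAt h (2 * Real.pi * Complex.I * c) 0) (u : ℂ) : h u = c * klein u τ := by
  set A : (ℂ → ℂ) → ℂ := fun f ↦ ∫ x : ℝ in 0..1, nome (x / 2) * f x with hA
  have hK := differentiable_klein him
  set k : ℂ → ℂ := fun u ↦ klein u τ with hk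
  have hint : ∀ f : ℂ → ℂ, Differentiable ℂ f →
      IntervalIntegrable (fun x : ℝ ↦ nome (x / 2) * f x) MeasureTheory.volume 0 1 := fun f hf ↦ by
    have hc : Continuous fun u : ℂ ↦ nome (u / 2) * f u :=
      Differentiable.continuous (𝕜 := ℂ) (by fun_prop)
    exact (hc.comp Complex.continuous_ofReal).intervalIntegrable _ _
  have hAk : A k ≠ 0 := fun h0 ↦ by
    have := eq_zero_of_quasiperiodic hK (fun u ↦ klein_add_one u τ) (fun u ↦ klein_add_tau u him) h0
    have h2 := hasDerivAt_klein_zero him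
    rw [show (fun u ↦ klein u τ) = 0 from this] at h2
    simpa [Real.pi_ne_zero] using h2.unique (hasDerivAt_const (0 : ℂ) (0 : ℂ))
  have hz : (fun u ↦ h u - A h / A k * k u) = 0 := by
    refine eq_zero_of_quasiperiodic (τ := τ) (by fun_prop) (fun u ↦ ?_) (fun u ↦ ?_) ?_
    · simp only [h1, hk, klein_add_one]; ring
    · simp only [hτ, hk, klein_add_tau u him]; ring
    · have : (fun x : ℝ ↦ nome (x / 2) * (h x - A h / A k * k x)) =
          fun x : ℝ ↦ nome (x / 2) * h x - A h / A k * (nome (x / 2) * k x) := by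
        funext x; ring
      rw [this, intervalIntegral.integral_sub (hint h hd) ((hint k hK).const_mul _),
        intervalIntegral.integral_const_mul]
      change A h - A h / A k * A k = 0
      field_simp
      ring
  have hu : ∀ u, h u = A h / A k * k u := fun u ↦ sub_eq_zero.mp (congrFun hz u)
  have hder := (hasDerivAt_klein_zero him).const_mul (A h / A k)
  rw [show (fun u ↦ A h / A k * klein u τ) = h from (funext hu).symm] at hder
  have := hder.unique hc
  have hpi : (2 * Real.pi * Complex.I : ℂ) ≠ 0 := by simp [Real.pi_ne_zero]
  have hcA : c = A h / A k := mul_left_cancel₀ hpi (by rw [← this]; ring)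
  rw [hu u, hcA]

/-! ### The modular transformation of the Klein form -/

lemma klein_add_int (u τ : ℂ) (n : ℤ) : klein (u + n) τ = (-1) ^ n * klein u τ := by
  induction n using Int.induction_on with
  | zero => simp
  | succ n ih =>
    push_cast at ih ⊢
    rw [← add_assoc, klein_add_one, ih, zpow_add₀ (by norm_num), zpow_one]
    ring
  | pred n ih =>
    have := klein_add_one (u + (-n - 1 : ℤ)) τ
    rw [zpow_sub₀ (by norm_num), zpow_one, div_neg, div_one, neg_mul, ← ih, ← neg_eq_iff_eq_neg,
      ← this]
    push_cast
    ring_nf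

lemma klein_add_int_mul_tau (u : ℂ) {τ : ℂ} (hτ : 0 < τ.im) (m : ℤ) :
    klein (u + m * τ) τ = (-1) ^ m * nome (-m ^ 2 * τ / 2 - m * u) * klein u τ := by
  induction m using Int.induction_on with
  | zero => simp
  | succ n ih =>
    push_cast at ih ⊢
    rw [add_mul, ← add_assoc, one_mul, klein_add_tau _ hτ, ih, zpow_add₀ (by norm_num), zpow_one,
      show ∀ A B C D : ℂ, -A * (B * C * D) = B * -1 * (A * C) * D by intros; ring, ← nome_add]
    ring_nf
  | pred n ih =>
    have := klein_add_tau (u + (-n - 1 : ℤ) * τ) hτ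
    rw [show u + (-n - 1 : ℤ) * τ + τ = u + (-n : ℤ) * τ by push_cast; ring, ih] at this
    rw [zpow_sub₀ (by norm_num), zpow_one]
    refine mul_left_cancel₀ (neg_ne_zero.mpr (nome_ne_zero _)) (this.symm.trans ?_)
    rw [show ∀ A B C D : ℂ, -A * (B / -1 * C * D) = B * (A * C) * D by intros; ring, ← nome_add]
    push_cast
    ring_nf

lemma klein_add_lattice (u : ℂ) {τ : ℂ} (hτ : 0 < τ.im) (m n : ℤ) :
    klein (u + m * τ + n) τ =
      (-1) ^ (m + n) * nome (-m ^ 2 * τ / 2 - m * u) * klein u τ := by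
  rw [klein_add_int, klein_add_int_mul_tau _ hτ, zpow_add₀ (by norm_num)]
  ring

lemma denom_ne_zero_of_det {a b c d : ℤ} (hdet : a * d - b * c = 1) {τ : ℂ} (hτ : 0 < τ.im) :
    (c * τ + d : ℂ) ≠ 0 := by
  intro h
  have him := congrArg Complex.im h
  simp only [Complex.add_im, Complex.mul_im, Complex.intCast_re, Complex.intCast_im, zero_mul,
    add_zero, Complex.zero_im, mul_eq_zero, Int.cast_eq_zero, hτ.ne', or_false] at him
  subst him
  simp only [Int.cast_zero, zero_mul, zero_add, Int.cast_eq_zero] at h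
  subst h
  simp at hdet

lemma coe_smul_eq (γ : SL(2, ℤ)) (τ : ℍ) :
    ((γ • τ : ℍ) : ℂ) = (γ 0 0 * τ + γ 0 1) / (γ 1 0 * τ + γ 1 1) := by
  rw [UpperHalfPlane.specialLinearGroup_apply]
  simp

lemma im_moebius_pos {a b c d : ℤ} (hdet : a * d - b * c = 1) {τ : ℂ} (hτ : 0 < τ.im) :
    0 < ((a * τ + b) / (c * τ + d) : ℂ).im := by
  have := coe_smul_eq ⟨!![a, b; c, d], by rw [Matrix.det_fin_two_of, hdet]⟩ ⟨τ, hτ⟩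
  simp only [Matrix.of_apply, Matrix.cons_val', Matrix.cons_val_zero, Matrix.cons_val_one,
    Matrix.cons_val_fin_one] at this
  rw [← this]
  exact UpperHalfPlane.im_pos _

lemma neg_one_zpow_eq_neg_one_of_odd {n : ℤ} (h : Odd n) : (-1 : ℂ) ^ n = -1 := h.neg_one_zpow

/-- The Klein form transforms like a Jacobi form of weight `-1` and index `1/2` under all of
`SL(2, ℤ)`: both sides are theta functions of degree one in `u`. -/
theorem klein_moebius {a b c d : ℤ} (hdet : a * d - b * c = 1) {τ : ℂ} (hτ : 0 < τ.im) (u : ℂ) :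
    klein (u / (c * τ + d)) ((a * τ + b) / (c * τ + d)) =
      (c * τ + d)⁻¹ * nome (c * u ^ 2 / (2 * (c * τ + d))) * klein u τ := by
  have hτ' := im_moebius_pos hdet hτ
  have hj := denom_ne_zero_of_det hdet hτ
  have hdetC : (a * d - b * c : ℂ) = 1 := by exact_mod_cast hdet
  set j : ℂ := c * τ + d with hjdef
  set τ' : ℂ := (a * τ + b) / j with hτ'def
  have e1 : 1 / j = (-c : ℤ) * τ' + (a : ℤ) := by
    rw [hτ'def]; push_cast; field_simp; rw [hjdef]; linear_combination -hdetC
  have e2 : τ / j = (d : ℤ) * τ' + (-b : ℤ) := by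
    rw [hτ'def]; push_cast; field_simp; rw [hjdef]; linear_combination -τ * hdetC
  have podd : ∀ x y z w : ℤ, x * w - y * z = 1 → Odd (x - z - x * z) := fun x y z w h ↦ by
    by_contra hne
    rw [Int.not_odd_iff_even] at hne
    have hx : Even x ∧ Even z := by
      rcases Int.even_or_odd x with hx | hx <;> rcases Int.even_or_odd z with hz | hz <;>
        grind [Int.even_sub]
    have : Even (1 : ℤ) := h ▸ ((hx.1.mul_right w).sub (hx.2.mul_left y))
    simp at this
  set h : ℂ → ℂ := fun u ↦ klein (u / j) τ' * nome (-c * u ^ 2 / (2 * j)) with hh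
  have hK := differentiable_klein hτ'
  have hK' : Differentiable ℂ fun u ↦ klein (u / j) τ' :=
    hK.comp (f := fun u ↦ u / j) (by fun_prop)
  have hd : Differentiable ℂ h := by fun_prop
  have h1 : ∀ u, h (u + 1) = -h u := fun u ↦ by
    simp only [hh]
    rw [add_div, e1, ← add_assoc, klein_add_lattice _ hτ',
      show ∀ A B C D : ℂ, A * B * C * D = A * (B * D) * C by intros; ring, ← nome_add,
      show -((-c : ℤ) : ℂ) ^ 2 * τ' / 2 - ((-c : ℤ) : ℂ) * (u / j) + -c * (u + 1) ^ 2 / (2 * j) =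
        ((-(a * c) : ℤ) : ℂ) / 2 + -c * u ^ 2 / (2 * j) by
        rw [show -(c : ℂ) * (u + 1) ^ 2 / (2 * j) =
          -c * u ^ 2 / (2 * j) - c * (u / j) - c / 2 * (1 / j) by field_simp; ring, e1]
        push_cast
        ring,
      nome_add, nome_int_half, ← mul_assoc, ← zpow_add₀ (by norm_num),
      neg_one_zpow_eq_neg_one_of_odd (by
        have := podd a b c d hdet
        rwa [show -c + a + -(a * c) = a - c - a * c by ring])]
    ring
  have h2 : ∀ u, h (u + τ) = -nome (-τ / 2 - u) * h u := fun u ↦ by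
    simp only [hh]
    rw [add_div, e2, ← add_assoc, klein_add_lattice _ hτ',
      show ∀ A B C D : ℂ, A * B * C * D = A * (B * D) * C by intros; ring, ← nome_add,
      show -((d : ℤ) : ℂ) ^ 2 * τ' / 2 - ((d : ℤ) : ℂ) * (u / j) + -c * (u + τ) ^ 2 / (2 * j) =
        ((-(d * b) : ℤ) : ℂ) / 2 + ((-τ / 2 - u) + -c * u ^ 2 / (2 * j)) by
        rw [hτ'def]
        push_cast
        field_simp
        rw [hjdef]
        linear_combination (-d * τ) * hdetC,
      nome_add, nome_int_half, ← mul_assoc, ← zpow_add₀ (by norm_num),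
      neg_one_zpow_eq_neg_one_of_odd (by
        have := podd d c b a (by linarith)
        rwa [show d + -b + -(d * b) = d - b - d * b by ring]), nome_add]
    ring
  have h3 : HasDerivAt h (2 * Real.pi * Complex.I * j⁻¹) 0 := by
    have hk : HasDerivAt (fun u ↦ klein (u / j) τ') (2 * Real.pi * Complex.I * j⁻¹) 0 := by
      have h0 := hasDerivAt_klein_zero hτ'
      rw [show (0 : ℂ) = 0 / j by simp] at h0
      refine (h0.comp 0 ((hasDerivAt_id (0 : ℂ)).div_const j)).congr_deriv ?_
      simp
    have hn : Differentiable ℂ fun u ↦ nome (-c * u ^ 2 / (2 * j)) := by fun_prop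
    refine (hk.mul (hn 0).hasDerivAt).congr_deriv ?_
    simp
  have hfin := eq_mul_klein_of_quasiperiodic hτ hd h1 h2 h3 u
  simp only [hh] at hfin
  rw [mul_right_comm, ← hfin, mul_assoc, ← nome_add]
  rw [show -c * u ^ 2 / (2 * j) + c * u ^ 2 / (2 * j) = 0 by ring, nome_zero, mul_one]

/-- The Klein form at a torsion point `x / n` with `2 n ∣ c`. -/
lemma klein_torsion_moebius {a b c d : ℤ} (hdet : a * d - b * c = 1) {τ : ℂ} (hτ : 0 < τ.im)
    {n : ℕ} (hn : n ≠ 0) (x m : ℤ) (hc : c = 2 * n * m) :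
    klein (x / n) ((a * τ + b) / (c * τ + d)) =
      (c * τ + d)⁻¹ * nome (-(x ^ 2 * m * d : ℤ) / n) * klein (x * d / n) τ := by
  have hj := denom_ne_zero_of_det hdet hτ
  have hn' : (n : ℂ) ≠ 0 := by exact_mod_cast hn
  have hcC : (c : ℂ) = 2 * n * m := by rw [hc]; push_cast; ring
  have := klein_moebius hdet hτ (x / n * (c * τ + d))
  rw [mul_div_cancel_right₀ _ hj] at this
  rw [this, show (x / n * (c * τ + d) : ℂ) = x * d / n + (2 * x * m : ℤ) * τ by
    rw [hcC]; push_cast; field_simp; ring, klein_add_int_mul_tau _ hτ,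
    show ∀ A B C D E : ℂ, A * B * (C * D * E) = C * (A * (B * D)) * E by intros; ring, ← nome_add,
    Even.neg_one_zpow (by rw [mul_assoc]; exact even_two_mul _), one_mul]
  congr 3
  rw [hcC] at hj ⊢
  push_cast
  field_simp
  ring

/-! ### Eta functions as products of Klein forms at torsion points -/

lemma prod_range_two_mul_add_one (f : ℕ → ℂ) (m : ℕ) :
    ∏ i ∈ Finset.range (2 * m + 1), f i =
      f 0 * ∏ j ∈ Finset.Ico 1 (m + 1), f j * f (2 * m + 1 - j) := by
  rw [Finset.prod_range_succ', two_mul, Finset.prod_range_add, mul_comm, ← Finset.prod_range_reflect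
    (fun x ↦ f (m + x + 1)), ← Finset.prod_mul_distrib, Finset.prod_Ico_eq_prod_range,
    Nat.add_sub_cancel]
  congr 1
  refine Finset.prod_congr rfl fun i hi ↦ ?_
  have := Finset.mem_range.mp hi
  rw [show m + (m - 1 - i) + 1 = m + m + 1 - (1 + i) by omega, add_comm 1 i]

lemma isPrimitiveRoot_nome {p : ℕ} (hp : Odd p) : IsPrimitiveRoot (nome (2 / p)) p := by
  have := Complex.isPrimitiveRoot_exp_of_coprime 2 p hp.pos.ne'
    (Nat.coprime_two_left.mpr hp)
  simpa [nome] using this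

/-- The factorization of `1 - x ^ p` with the nontrivial roots of unity paired with their
inverses. -/
lemma prod_one_sub_roots {p : ℕ} (hp : Odd p) (x : ℂ) :
    (1 - x) * ∏ j ∈ Finset.Ico 1 (p / 2).succ,
      (1 - nome (2 * j / p) * x) * (1 - nome (-(2 * j / p)) * x) = 1 - x ^ p := by
  have hω := isPrimitiveRoot_nome hp
  have hp0 : (p : ℂ) ≠ 0 := by exact_mod_cast hp.pos.ne'
  have : NeZero p := ⟨hp.pos.ne'⟩
  have hprod := hω.pow_sub_pow_eq_prod_sub_mul 1 x hp.pos
  rw [one_pow] at hprod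
  have hset : ∏ ζ ∈ Polynomial.nthRootsFinset p (1 : ℂ), (1 - ζ * x) =
      ∏ i ∈ Finset.range p, (1 - nome (2 / p) ^ i * x) := by
    symm
    refine Finset.prod_bij (fun i _ ↦ nome (2 / p) ^ i) (fun i _ ↦ ?_) (fun i hi j hj h ↦ ?_)
      (fun ζ hζ ↦ ?_) (fun _ _ ↦ rfl)
    · rw [Polynomial.mem_nthRootsFinset hp.pos, ← pow_mul, mul_comm, pow_mul, hω.pow_eq_one, one_pow]
    · exact hω.pow_inj (Finset.mem_range.mp hi) (Finset.mem_range.mp hj) h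
    · obtain ⟨i, hi, rfl⟩ := hω.eq_pow_of_pow_eq_one
        ((Polynomial.mem_nthRootsFinset hp.pos 1).mp hζ)
      exact ⟨i, Finset.mem_range.mpr hi, rfl⟩
  obtain ⟨m, hm⟩ := hp
  rw [hprod, hset]
  conv_rhs => rw [hm, prod_range_two_mul_add_one, ← hm]
  rw [pow_zero, one_mul, show p / 2 = m by omega]
  congr 1
  refine Finset.prod_congr rfl fun j hj ↦ ?_
  have hj' := Finset.mem_Ico.mp hj
  have h1 : nome (2 * j / p) = nome (2 / p) ^ j := by
    rw [← nome_nat_mul]; ring_nf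
  have h2 : nome (-(2 * j / p)) = nome (2 / p) ^ (p - j) := by
    rw [← nome_nat_mul, Nat.cast_sub (by omega), sub_mul, mul_div_cancel₀ _ hp0, nome_sub, nome_neg,
      show (2 : ℂ) = ((2 : ℤ) : ℂ) by norm_num, nome_int, one_div, ← mul_div_assoc, mul_comm]
  rw [h1, h2]

lemma multipliable_nome {τ : ℂ} (hτ : 0 < τ.im) (x : ℂ) :
    Multipliable fun n : ℕ ↦ 1 - x * nome τ ^ (n + 1) := by
  simpa [pow_succ', mul_assoc] using multipliable_qPoch (x * nome τ) (norm_nome_lt_one hτ)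

lemma qPoch_nome_add (u τ : ℂ) :
    qPoch (nome (u + τ)) (nome τ) = ∏' n : ℕ, (1 - nome u * nome τ ^ (n + 1)) := by
  simp only [qPoch, nome_add, pow_succ', mul_assoc]

lemma qPoch_nome_self (τ : ℂ) :
    qPoch (nome τ) (nome τ) = ∏' n : ℕ, (1 - nome τ ^ (n + 1)) := by
  simp only [qPoch, pow_succ']

lemma im_natCast_mul_pos {τ : ℂ} (hτ : 0 < τ.im) {n : ℕ} (hn : 0 < n) : 0 < ((n : ℂ) * τ).im := by
  have : (0 : ℝ) < n := by exact_mod_cast hn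
  simpa using mul_pos this hτ

lemma prod_qPoch_torsion {p : ℕ} (hp : Odd p) {τ : ℂ} (hτ : 0 < τ.im) :
    qPoch (nome τ) (nome τ) * ∏ j ∈ Finset.Ico 1 (p / 2).succ,
      (qPoch (nome (2 * j / p + τ)) (nome τ) * qPoch (nome (-(2 * j / p) + τ)) (nome τ)) =
    qPoch (nome (p * τ)) (nome (p * τ)) := by
  have hm := multipliable_nome hτ
  simp only [qPoch_nome_add, qPoch_nome_self]
  simp_rw [← (hm _).tprod_mul (hm _)]
  rw [← Multipliable.tprod_finsetProd fun j _ ↦ (hm _).mul (hm _),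
    ← Multipliable.tprod_mul (by simpa using hm 1)
      (multipliable_prod fun j _ ↦ (hm _).mul (hm _))]
  refine tprod_congr fun n ↦ ?_
  rw [prod_one_sub_roots hp, nome_nat_mul, ← pow_mul, ← pow_mul, mul_comm p]

/-- For odd `p`, the `p`-th level raising of the eta function is a product of Klein forms over the
half-system `2, 4, …, p - 1` of nonzero residues modulo `p`. -/
theorem eta_mul_eq_prod_klein {p : ℕ} (hp : Odd p) : ∃ C : ℂ, C ≠ 0 ∧ ∀ τ : ℂ, 0 < τ.im →
    ModularForm.eta (p * τ) = C * ModularForm.eta τ ^ p *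
      ∏ j ∈ Finset.Ico 1 (p / 2).succ, klein (2 * j / p) τ := by
  have hp0 : (p : ℂ) ≠ 0 := by exact_mod_cast hp.pos.ne'
  set D : ℂ := ∏ j ∈ Finset.Ico 1 (p / 2).succ, (nome (2 * j / p / 2) - nome (-(2 * j / p) / 2))
    with hD
  have hD0 : D ≠ 0 := by
    refine Finset.prod_ne_zero_iff.mpr fun j hj h ↦ ?_
    have hj' := Finset.mem_Ico.mp hj
    rw [sub_eq_zero, neg_div, nome_neg, ← mul_eq_one_iff_eq_inv₀ (nome_ne_zero _), ← nome_add,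
      add_halves, show (2 * j / p : ℂ) = j * (2 / p) by ring, nome_nat_mul] at h
    have := (isPrimitiveRoot_nome hp).dvd_of_pow_eq_one _ h
    have := Nat.le_of_dvd (by omega) this
    have := hp.pos
    omega
  refine ⟨D⁻¹, inv_ne_zero hD0, fun τ hτ ↦ ?_⟩
  have hP := qPoch_nome_ne_zero hτ
  have key := prod_qPoch_torsion hp hτ
  have hk : ∏ j ∈ Finset.Ico 1 (p / 2).succ, klein (2 * j / p) τ =
      D * (∏ j ∈ Finset.Ico 1 (p / 2).succ, (qPoch (nome (2 * j / p + τ)) (nome τ) *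
        qPoch (nome (-(2 * j / p) + τ)) (nome τ))) / (qPoch (nome τ) (nome τ) ^ 2) ^ (p / 2) := by
    simp only [klein, Finset.prod_div_distrib, Finset.prod_mul_distrib, Finset.prod_const,
      Nat.card_Ico, Nat.succ_sub_one, hD]
  rw [hk, eta_eq, eta_eq, ← key, mul_pow, ← nome_nat_mul, mul_div_assoc]
  have hpow : qPoch (nome τ) (nome τ) ^ p =
      qPoch (nome τ) (nome τ) * (qPoch (nome τ) (nome τ) ^ 2) ^ (p / 2) := by
    rw [← pow_mul, ← pow_succ', Nat.two_mul_div_two_add_one_of_odd hp]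
  rw [hpow]
  field_simp

/-- The analogue of `eta_mul_eq_prod_klein` at the prime `2`, by means of the point of order `4`. -/
theorem eta_four_mul_eq : ∃ C : ℂ, C ≠ 0 ∧ ∀ τ : ℂ, 0 < τ.im →
    ModularForm.eta (4 * τ) =
      C * (ModularForm.eta (2 * τ) * ModularForm.eta τ ^ 2) * klein (1 / 4) τ := by
  set D : ℂ := nome (1 / 4 / 2) - nome (-(1 / 4) / 2) with hD
  have h4 : nome (1 / 4) ^ 2 = -1 := by
    rw [← nome_half, ← nome_nat_mul]; norm_num
  have h4' : nome (-(1 / 4)) = -nome (1 / 4) := by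
    rw [nome_neg, inv_eq_iff_eq_inv, ← mul_eq_one_iff_eq_inv₀ (by simp)]
    linear_combination -h4
  have hD0 : D ≠ 0 := fun h ↦ by
    rw [hD, sub_eq_zero, neg_div, nome_neg, ← mul_eq_one_iff_eq_inv₀ (nome_ne_zero _), ← nome_add,
      add_halves] at h
    rw [h] at h4
    norm_num at h4
  refine ⟨D⁻¹, inv_ne_zero hD0, fun τ hτ ↦ ?_⟩
  have hP := qPoch_nome_ne_zero hτ
  have hm := multipliable_nome hτ
  have h2 : 0 < (2 * τ).im := by simpa using hτ
  have key : qPoch (nome (2 * τ)) (nome (2 * τ)) * (qPoch (nome (1 / 4 + τ)) (nome τ) *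
      qPoch (nome (-(1 / 4) + τ)) (nome τ)) = qPoch (nome (4 * τ)) (nome (4 * τ)) := by
    simp only [qPoch_nome_add, qPoch_nome_self]
    rw [← (hm _).tprod_mul (hm _), ← Multipliable.tprod_mul
      (by simpa using multipliable_nome h2 1) ((hm _).mul (hm _))]
    refine tprod_congr fun n ↦ ?_
    have e2 : nome (2 * τ) = nome τ ^ 2 := by exact_mod_cast nome_nat_mul 2 τ
    have e4 : nome (4 * τ) = nome τ ^ 4 := by exact_mod_cast nome_nat_mul 4 τ
    rw [e2, e4, h4', show ∀ n, (nome τ ^ 2) ^ (n + 1) = (nome τ ^ (n + 1)) ^ 2 by intros; ring,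
      show ∀ n, (nome τ ^ 4) ^ (n + 1) = (nome τ ^ (n + 1)) ^ 4 by intros; ring]
    generalize nome τ ^ (n + 1) = x
    linear_combination (-(1 - x ^ 2) * x ^ 2) * h4
  rw [eta_eq, eta_eq, eta_eq, ← key, klein, ← hD, mul_pow, ← nome_nat_mul,
    show 4 * τ / 24 = 2 * τ / 24 + (2 : ℕ) * (τ / 24) by push_cast; ring, nome_add]
  field_simp

/-! ### The multiplier system of the square of the eta function -/

/-- The exponent of the multiplier of `η ^ 2`: a polynomial in the entries of a matrix of
determinant one which, modulo `12`, is a homomorphism from `SL(2, ℤ)` onto `ℤ / 12`. -/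
def etaExponent {R : Type*} [CommRing R] (a b c d : R) : R :=
  (1 - c ^ 2) * (b * d + 3 * (c - 1) * d + c + 3) + c * (a + d - 3)

lemma etaExponent_mod_four : ∀ a b c d : ZMod 4, a * d - b * c = 1 →
    etaExponent a (a + b) c (c + d) = etaExponent a b c d + 1 ∧
      etaExponent b (-a) d (-c) = etaExponent a b c d + 1 := by
  unfold etaExponent
  decide

lemma etaExponent_mod_three : ∀ a b c d : ZMod 3, a * d - b * c = 1 →
    etaExponent a (a + b) c (c + d) = etaExponent a b c d + 1 ∧
      etaExponent b (-a) d (-c) = etaExponent a b c d := by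
  unfold etaExponent
  decide

/-- A function whose behaviour under the two generators of `SL(2, ℤ)` is given by an additive
character transforms by that character under the whole group. -/
lemma slash_eq_of_generators {N : ℕ} [NeZero N] {k : ℤ} {f : ℍ → ℂ} {P : SL(2, ℤ) → ZMod N}
    {s t : ZMod N} (h1 : P 1 = 0) (hPS : ∀ γ, P (γ * ModularGroup.S) = P γ + s)
    (hPT : ∀ γ, P (γ * ModularGroup.T) = P γ + t)
    (hS : f ∣[k] ModularGroup.S = ZMod.stdAddChar s • f)
    (hT : f ∣[k] ModularGroup.T = ZMod.stdAddChar t • f) (γ : SL(2, ℤ)) :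
    f ∣[k] γ = ZMod.stdAddChar (P γ) • f := by
  have hstep : ∀ (g : SL(2, ℤ)) (u : ZMod N), (∀ γ, P (γ * g) = P γ + u) →
      f ∣[k] g = ZMod.stdAddChar u • f → ∀ γ, f ∣[k] γ = ZMod.stdAddChar (P γ) • f →
      f ∣[k] (γ * g) = ZMod.stdAddChar (P (γ * g)) • f := fun g u hg hf γ h ↦ by
    rw [SlashAction.slash_mul, h, ModularForm.SL_smul_slash, hf, hg, AddChar.map_add_eq_mul,
      smul_smul]
  have hinv : ∀ (g : SL(2, ℤ)) (u : ZMod N), (∀ γ, P (γ * g) = P γ + u) →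
      f ∣[k] g = ZMod.stdAddChar u • f →
      (∀ γ, P (γ * g⁻¹) = P γ + -u) ∧ f ∣[k] g⁻¹ = ZMod.stdAddChar (-u) • f := fun g u hg hf ↦ by
    refine ⟨fun γ ↦ ?_, ?_⟩
    · have := hg (γ * g⁻¹)
      rw [inv_mul_cancel_right] at this
      rw [this, add_neg_cancel_right]
    · have h : (f ∣[k] g) ∣[k] g⁻¹ = f := by
        rw [← SlashAction.slash_mul, mul_inv_cancel, SlashAction.slash_one]
      rw [hf, ModularForm.SL_smul_slash] at h
      have h2 := congrArg (ZMod.stdAddChar (-u) • ·) h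
      simpa only [smul_smul, ← AddChar.map_add_eq_mul, neg_add_cancel, AddChar.map_zero_eq_one,
        one_smul] using h2
  have hγ : γ ∈ Subgroup.closure {ModularGroup.S, ModularGroup.T} := by
    rw [SpecialLinearGroup.SL2Z_generators]
    trivial
  induction hγ using Subgroup.closure_induction_right with
  | one => rw [h1, AddChar.map_zero_eq_one, one_smul, SlashAction.slash_one]
  | mul_right x hx y hy ih =>
    rcases hy with rfl | rfl
    · exact hstep _ _ hPS hS _ ih
    · exact hstep _ _ hPT hT _ ih
  | mul_inv_cancel x hx y hy ih =>
    rcases hy with rfl | rfl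
    · exact hstep _ _ (hinv _ _ hPS hS).1 (hinv _ _ hPS hS).2 _ ih
    · exact hstep _ _ (hinv _ _ hPT hT).1 (hinv _ _ hPT hT).2 _ ih

lemma eta_add_one (z : ℂ) : ModularForm.eta (z + 1) = nome (1 / 24) * ModularForm.eta z := by
  rw [eta_eq, eta_eq, nome_add_one, add_div, nome_add]
  ring

lemma eta_neg_inv_sq (τ : ℍ) :
    ModularForm.eta (-1 / (τ : ℂ)) ^ 2 = -Complex.I * τ * ModularForm.eta τ ^ 2 := by
  have h := ModularForm.eta_comp_eq_csqrt_I_inv τ.2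
  simp only [Function.comp_apply, Pi.smul_apply, Pi.mul_apply, smul_eq_mul] at h
  have hs : ∀ z : ℂ, Complex.sqrt z ^ 2 = z := fun z ↦ by
    rw [Complex.sqrt, ← Complex.cpow_nat_mul]
    norm_num
  change ModularForm.eta (-1 / (τ : ℂ)) = _ at h
  rw [h, mul_pow, inv_pow, mul_pow, hs, hs, Complex.inv_I]
  ring

lemma coe_T_smul (τ : ℍ) : ((ModularGroup.T • τ : ℍ) : ℂ) = τ + 1 := by
  rw [UpperHalfPlane.modular_T_smul]
  simp [add_comm]

lemma coe_S_smul (τ : ℍ) : ((ModularGroup.S • τ : ℍ) : ℂ) = -1 / τ := by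
  rw [UpperHalfPlane.modular_S_smul]
  simp [neg_div, inv_neg]

lemma slash_apply_eq (f : ℍ → ℂ) (k : ℤ) (γ : SL(2, ℤ)) (τ : ℍ) :
    (f ∣[k] γ) τ = f (γ • τ) * (γ 1 0 * τ + γ 1 1 : ℂ) ^ (-k) := by
  rw [ModularForm.SL_slash_apply, UpperHalfPlane.denom]
  simp

lemma eta_pow_slash_T (m : ℕ) (k : ℤ) {N : ℕ} [NeZero N] (hN : m * N = 24) :
    (fun τ : ℍ ↦ ModularForm.eta τ ^ m) ∣[k] ModularGroup.T =
      ZMod.stdAddChar (1 : ZMod N) • fun τ : ℍ ↦ ModularForm.eta τ ^ m := by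
  funext τ
  have hN0 : (N : ℂ) ≠ 0 := by exact_mod_cast NeZero.ne N
  have h24 : (m * N : ℂ) = 24 := by exact_mod_cast hN
  have he : ZMod.stdAddChar (1 : ZMod N) = nome (1 / 24) ^ m := by
    have := ZMod.stdAddChar_coe (N := N) 1
    rw [Int.cast_one] at this
    rw [this, ← nome_nat_mul, nome, ← h24]
    congr 1
    have : (m : ℂ) ≠ 0 := fun h ↦ by rw [h] at h24; norm_num at h24
    push_cast
    field_simp
  rw [slash_apply_eq, coe_T_smul, eta_add_one, mul_pow, ← he]
  simp [ModularGroup.T]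

lemma eta_pow_slash_S (s : ℕ) :
    (fun τ : ℍ ↦ ModularForm.eta τ ^ (2 * s)) ∣[(s : ℤ)] ModularGroup.S =
      (-Complex.I) ^ s • fun τ : ℍ ↦ ModularForm.eta τ ^ (2 * s) := by
  funext τ
  have hτ := UpperHalfPlane.ne_zero τ
  rw [slash_apply_eq, coe_S_smul, pow_mul, eta_neg_inv_sq]
  simp only [ModularGroup.S, Pi.smul_apply, smul_eq_mul, pow_mul]
  rw [mul_pow, mul_pow]
  simp
  field_simp

lemma mul_S_apply (γ : SL(2, ℤ)) : (γ * ModularGroup.S) 0 0 = γ 0 1 ∧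
    (γ * ModularGroup.S) 0 1 = -γ 0 0 ∧ (γ * ModularGroup.S) 1 0 = γ 1 1 ∧
    (γ * ModularGroup.S) 1 1 = -γ 1 0 := by
  simp [Matrix.SpecialLinearGroup.coe_mul, Matrix.mul_apply, ModularGroup.coe_S,
    Fin.sum_univ_two]

lemma mul_T_apply (γ : SL(2, ℤ)) : (γ * ModularGroup.T) 0 0 = γ 0 0 ∧
    (γ * ModularGroup.T) 0 1 = γ 0 0 + γ 0 1 ∧ (γ * ModularGroup.T) 1 0 = γ 1 0 ∧
    (γ * ModularGroup.T) 1 1 = γ 1 0 + γ 1 1 := by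
  simp [Matrix.SpecialLinearGroup.coe_mul, Matrix.mul_apply, ModularGroup.coe_T,
    Fin.sum_univ_two]

lemma eta_pow_slash {s N : ℕ} [NeZero N] (hN : 2 * s * N = 24) {σ : ZMod N}
    (hσ : ZMod.stdAddChar σ = (-Complex.I) ^ s)
    (hP : ∀ a b c d : ZMod N, a * d - b * c = 1 →
      etaExponent a (a + b) c (c + d) = etaExponent a b c d + 1 ∧
        etaExponent b (-a) d (-c) = etaExponent a b c d + σ)
    {a b c d : ℤ} (hdet : a * d - b * c = 1) {τ : ℂ} (hτ : 0 < τ.im) :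
    ModularForm.eta ((a * τ + b) / (c * τ + d)) ^ (2 * s) =
      ZMod.stdAddChar (etaExponent (a : ZMod N) b c d) * (c * τ + d) ^ s *
        ModularForm.eta τ ^ (2 * s) := by
  have hj := denom_ne_zero_of_det hdet hτ
  have hdetγ : ∀ γ : SL(2, ℤ), ((γ 0 0 : ZMod N) * γ 1 1 - γ 0 1 * γ 1 0 : ZMod N) = 1 := fun γ ↦ by
    have := Matrix.SpecialLinearGroup.det_coe γ
    rw [Matrix.det_fin_two] at this
    exact_mod_cast congrArg (Int.cast : ℤ → ZMod N) this
  have key := slash_eq_of_generators (f := fun τ : ℍ ↦ ModularForm.eta τ ^ (2 * s)) (k := s)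
    (P := fun γ ↦ etaExponent (γ 0 0 : ZMod N) (γ 0 1) (γ 1 0) (γ 1 1)) (s := σ) (t := 1)
    (by simp [etaExponent])
    (fun γ ↦ by
      obtain ⟨h1, h2, h3, h4⟩ := mul_S_apply γ
      rw [← (hP _ _ _ _ (hdetγ γ)).2, h1, h2, h3, h4]
      push_cast
      rfl)
    (fun γ ↦ by
      obtain ⟨h1, h2, h3, h4⟩ := mul_T_apply γ
      rw [← (hP _ _ _ _ (hdetγ γ)).1, h1, h2, h3, h4]
      push_cast
      rfl)
    (by rw [eta_pow_slash_S, hσ]) (eta_pow_slash_T _ _ hN)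
  let γ : SL(2, ℤ) := ⟨!![a, b; c, d], by rw [Matrix.det_fin_two_of, hdet]⟩
  have h2 := congrFun (key γ) ⟨τ, hτ⟩
  rw [slash_apply_eq, coe_smul_eq] at h2
  simp only [γ, Matrix.of_apply, Matrix.cons_val', Matrix.cons_val_zero, Matrix.cons_val_one,
    Matrix.cons_val_fin_one, Pi.smul_apply, smul_eq_mul, zpow_neg, zpow_natCast] at h2
  rw [mul_inv_eq_iff_eq_mul₀ (pow_ne_zero _ hj)] at h2
  rw [h2]
  ring

lemma stdAddChar_four (j : ℕ) : ZMod.stdAddChar (j : ZMod 4) = Complex.I ^ j := by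
  have := ZMod.stdAddChar_coe (N := 4) j
  rw [Int.cast_natCast] at this
  have hI : Complex.I ^ j = exp (j * (Real.pi / 2 * Complex.I)) := by
    rw [Complex.exp_nat_mul, Complex.exp_pi_div_two_mul_I]
  rw [this, hI]
  congr 1
  push_cast
  ring

/-- On matrices congruent to a diagonal matrix modulo `12`, the function `η ^ 2` has weight one and
the nontrivial character modulo `4`. It is recovered from `η ^ 18 / η ^ 16`. -/
theorem eta_sq_moebius {a b c d : ℤ} (hdet : a * d - b * c = 1) (hb : 12 ∣ b) (hc : 12 ∣ c) {τ : ℂ}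
    (hτ : 0 < τ.im) :
    ModularForm.eta ((a * τ + b) / (c * τ + d)) ^ 2 =
      (ZMod.χ₄ d : ℂ) * (c * τ + d) * ModularForm.eta τ ^ 2 := by
  have hj := denom_ne_zero_of_det hdet hτ
  have h6 := eta_pow_slash (s := 3) (N := 4) (σ := 1) (by norm_num)
    (by
      have := stdAddChar_four 1
      rw [Nat.cast_one] at this
      rw [this, neg_pow, Complex.I_pow_three]; ring)
    etaExponent_mod_four hdet hτ
  have h8 := eta_pow_slash (s := 4) (N := 3) (σ := 0) (by norm_num)
    (by rw [AddChar.map_zero_eq_one, neg_pow, Complex.I_pow_four]; ring)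
    (fun a b c d h ↦ by simpa using etaExponent_mod_three a b c d h) hdet hτ
  have hb4 : (b : ZMod 4) = 0 := (ZMod.intCast_zmod_eq_zero_iff_dvd b 4).mpr
    (dvd_trans (by norm_num) hb)
  have hc4 : (c : ZMod 4) = 0 := (ZMod.intCast_zmod_eq_zero_iff_dvd c 4).mpr
    (dvd_trans (by norm_num) hc)
  have hb3 : (b : ZMod 3) = 0 := (ZMod.intCast_zmod_eq_zero_iff_dvd b 3).mpr
    (dvd_trans (by norm_num) hb)
  have hc3 : (c : ZMod 3) = 0 := (ZMod.intCast_zmod_eq_zero_iff_dvd c 3).mpr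
    (dvd_trans (by norm_num) hc)
  have hd : (a : ZMod 4) * d = 1 := by
    have := congrArg (Int.cast : ℤ → ZMod 4) hdet
    push_cast at this
    rwa [hb4, zero_mul, sub_zero] at this
  have hE4 : ZMod.stdAddChar (etaExponent (a : ZMod 4) b c d) = (ZMod.χ₄ d : ℂ) := by
    rw [hb4, hc4]
    generalize (a : ZMod 4) = x at hd
    generalize (d : ZMod 4) = y at hd ⊢
    have hy : y = 1 ∨ y = 3 := by revert x y; decide
    rcases hy with rfl | rfl
    · rw [show etaExponent x 0 0 (1 : ZMod 4) = 0 by simp [etaExponent], AddChar.map_zero_eq_one,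
        show ZMod.χ₄ 1 = 1 by decide, Int.cast_one]
    · have h2 := stdAddChar_four 2
      rw [show etaExponent x 0 0 (3 : ZMod 4) = (2 : ℕ) by
        simp only [etaExponent, zero_mul, add_zero]; decide, h2, Complex.I_sq,
        show ZMod.χ₄ 3 = -1 by decide]
      norm_num
  have hE3 : etaExponent (a : ZMod 3) b c d = 0 := by
    rw [hb3, hc3, etaExponent]
    have : (3 : ZMod 3) = 0 := by decide
    simp [this]
  rw [hE4] at h6
  rw [hE3, AddChar.map_zero_eq_one, one_mul] at h8
  norm_num only at h6 h8
  have hη := ModularForm.eta_ne_zero (z := τ) hτ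
  have hη' := ModularForm.eta_ne_zero (z := (a * τ + b) / (c * τ + d)) (im_moebius_pos hdet hτ)
  set χ : ℂ := (ZMod.χ₄ d : ℂ) with hχ
  have hχ3 : χ ^ 3 = χ := by
    have : ∀ y : ZMod 4, ZMod.χ₄ y ^ 3 = ZMod.χ₄ y := by decide
    rw [hχ]
    exact_mod_cast this d
  set x := ModularForm.eta ((a * τ + b) / (c * τ + d))
  have h16 : x ^ 16 ≠ 0 := pow_ne_zero _ hη'
  refine mul_left_cancel₀ h16 ?_
  calc x ^ 16 * x ^ 2 = (x ^ 6) ^ 3 := by ring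
    _ = χ ^ 3 * ((c * τ + d) ^ 4 * ModularForm.eta τ ^ 8) ^ 2 *
        ((c * τ + d) * ModularForm.eta τ ^ 2) := by rw [h6]; ring
    _ = _ := by rw [← h8, hχ3]; ring

/-! ### Gauss's lemma and the quadratic character of `η(n τ) / η(τ)` -/

/-- Gauss's lemma: multiplication by `d` acts on a product of values of an odd function over a
half-system modulo `p` through the Legendre symbol of `d`. -/
lemma prod_odd_function {p : ℕ} [Fact p.Prime] (hp : p ≠ 2) {f : ZMod p → ℂ}
    (hf : ∀ x, f (-x) = -f x) {d : ℤ} (hd : (d : ZMod p) ≠ 0) :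
    ∏ j ∈ Finset.Ico 1 (p / 2).succ, f (d * (j : ℕ)) =
      legendreSym p d * ∏ j ∈ Finset.Ico 1 (p / 2).succ, f (j : ℕ) := by
  have hstep : ∀ y : ZMod p, f y =
      (if p / 2 < y.val then -1 else 1) * f (y.valMinAbs.natAbs : ℕ) := fun y ↦ by
    rw [ZMod.natCast_natAbs_valMinAbs]
    split_ifs with h1 h2 h2
    · omega
    · rw [hf]; ring
    · ring
    · omega
  rw [Finset.prod_congr rfl fun j _ ↦ hstep (d * (j : ℕ)), Finset.prod_mul_distrib,
    Finset.prod_ite, Finset.prod_const, Finset.prod_const_one, mul_one, ZMod.gauss_lemma hp hd]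
  congr 1
  · push_cast
    rfl
  · have := congrArg (fun s : Multiset ℕ ↦ (s.map fun x ↦ f (x : ℕ)).prod)
      (ZMod.Ico_map_valMinAbs_natAbs_eq_Ico_map_id p (d : ZMod p) hd)
    rw [Multiset.map_map, Multiset.map_id'] at this
    exact this

lemma klein_add_two_mul_int (u τ : ℂ) (t : ℤ) : klein (u + 2 * t) τ = klein u τ := by
  have := klein_add_int u τ (2 * t)
  rw [Even.neg_one_zpow (even_two_mul t), one_mul] at this
  exact_mod_cast this

/-- The value of the Klein form at `2 z / p` depends only on `z` modulo `p`. -/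
lemma klein_two_mul_div {p : ℕ} [NeZero p] (τ : ℂ) (z : ℤ) :
    klein (2 * z / p) τ = klein (2 * (z : ZMod p).val / p) τ := by
  have hp : (p : ℂ) ≠ 0 := by exact_mod_cast NeZero.ne p
  have h1 : (((z : ZMod p).val : ℤ) : ℂ) = ((z % p : ℤ) : ℂ) := by rw [ZMod.val_intCast]
  have h2 : (z : ℂ) = ((z % p : ℤ) : ℂ) + p * (z / p : ℤ) := by
    exact_mod_cast (Int.emod_add_mul_ediv z p).symm
  rw [Int.cast_natCast] at h1
  rw [h1, ← klein_add_two_mul_int (2 * ((z % p : ℤ) : ℂ) / p) τ (z / p)]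
  congr 1
  rw [h2]
  field_simp

lemma klein_two_mul_div_neg {p : ℕ} [NeZero p] (τ : ℂ) (x : ZMod p) :
    klein (2 * (-x).val / p) τ = -klein (2 * x.val / p) τ := by
  have h := klein_two_mul_div (p := p) τ (-(x.val : ℤ))
  rw [show ((-(x.val : ℤ) : ℤ) : ZMod p) = -x by simp] at h
  rw [← h, ← klein_neg]
  congr 1
  push_cast
  ring

lemma prod_nome {ι : Type*} (s : Finset ι) (f : ι → ℂ) :
    ∏ i ∈ s, nome (f i) = nome (∑ i ∈ s, f i) := by
  classical
  induction s using Finset.induction_on with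
  | empty => simp
  | insert i s hi ih => rw [Finset.prod_insert hi, Finset.sum_insert hi, nome_add, ih]

lemma six_mul_sum_sq (h : ℕ) :
    6 * ∑ j ∈ Finset.Ico 1 h.succ, (j : ℤ) ^ 2 = h * (h + 1) * (2 * h + 1) := by
  induction h with
  | zero => simp
  | succ n ih =>
    rw [Finset.sum_Ico_succ_top (by omega), mul_add, ih]
    push_cast
    ring

/-- The product of Klein forms over a half-system modulo `p` transforms by the Legendre symbol. The
roots of unity from the individual factors cancel because `∑ j ^ 2` over a half-system is
`p (p ^ 2 - 1) / 24`. -/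
lemma prod_klein_moebius {p : ℕ} [Fact p.Prime] (hp : p ≠ 2) {a b c d : ℤ}
    (hdet : a * d - b * c = 1) (hc : (24 * p : ℤ) ∣ c) {τ : ℂ} (hτ : 0 < τ.im) :
    (c * τ + d : ℂ) ^ (p / 2) * ∏ j ∈ Finset.Ico 1 (p / 2).succ,
        klein (2 * j / p) ((a * τ + b) / (c * τ + d)) =
      legendreSym p d * ∏ j ∈ Finset.Ico 1 (p / 2).succ, klein (2 * j / p) τ := by
  have hprime : p.Prime := Fact.out
  have hodd : Odd p := hprime.odd_of_ne_two hp
  have hj := denom_ne_zero_of_det hdet hτ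
  have hp0 : (p : ℂ) ≠ 0 := by exact_mod_cast hprime.ne_zero
  have : NeZero p := ⟨hprime.ne_zero⟩
  obtain ⟨m, hm⟩ := hc
  have hd : (d : ZMod p) ≠ 0 := fun h ↦ by
    have h1 := (ZMod.intCast_zmod_eq_zero_iff_dvd d p).mp h
    have h2 : (p : ℤ) ∣ 1 := by
      rw [← hdet]
      exact dvd_sub (h1.mul_left a) ((Dvd.intro (24 * m) (by rw [hm]; ring) : (p : ℤ) ∣ c).mul_left b)
    exact hprime.one_lt.ne' (by exact_mod_cast Int.eq_one_of_dvd_one (by positivity) h2)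
  have hfac : ∀ j ∈ Finset.Ico 1 (p / 2).succ,
      klein (2 * (j : ℕ) / p) ((a * τ + b) / (c * τ + d)) =
        (c * τ + d)⁻¹ * nome (-((2 * j) ^ 2 * (12 * m) * d) / p) *
          klein (2 * ((d * (j : ℕ) : ZMod p)).val / p) τ := fun j _ ↦ by
    have h := klein_torsion_moebius hdet hτ hprime.ne_zero (2 * j) (12 * m) (by rw [hm]; ring)
    have h2 := klein_two_mul_div (p := p) τ (d * j)
    push_cast at h h2
    rw [h, ← h2, show (2 * (j : ℂ) * d / p) = 2 * (d * j) / p by ring]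
  rw [Finset.prod_congr rfl hfac, Finset.prod_mul_distrib, Finset.prod_mul_distrib,
    Finset.prod_const, Nat.card_Ico, Nat.succ_sub_one, prod_nome,
    prod_odd_function hp (f := fun x ↦ klein (2 * x.val / p) τ) (klein_two_mul_div_neg τ) hd,
    show ∀ A B C D E : ℂ, A * (B * C * (D * E)) = A * B * C * (D * E) by intros; ring,
    inv_pow, mul_inv_cancel₀ (pow_ne_zero _ hj), one_mul]
  have hsum : ∑ j ∈ Finset.Ico 1 (p / 2).succ, (-((2 * (j : ℂ)) ^ 2 * (12 * m) * d) / p) =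
      ((-(8 * m * d * ((p / 2 : ℕ) * ((p / 2 : ℕ) + 1))) : ℤ) : ℂ) := by
    have h6 : (6 * ∑ j ∈ Finset.Ico 1 (p / 2).succ, (j : ℂ) ^ 2) =
        (p / 2 : ℕ) * ((p / 2 : ℕ) + 1) * p := by
      have := six_mul_sum_sq (p / 2)
      rw [show (2 * ((p / 2 : ℕ) : ℤ) + 1) = p by exact_mod_cast Nat.two_mul_div_two_add_one_of_odd hodd]
        at this
      exact_mod_cast congrArg (Int.cast : ℤ → ℂ) this
    rw [show ∑ j ∈ Finset.Ico 1 (p / 2).succ, (-((2 * (j : ℂ)) ^ 2 * (12 * m) * d) / p) =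
      -(8 * m * d) / p * (6 * ∑ j ∈ Finset.Ico 1 (p / 2).succ, (j : ℂ) ^ 2) by
      rw [Finset.mul_sum, Finset.mul_sum]
      refine Finset.sum_congr rfl fun j _ ↦ ?_
      ring, h6]
    generalize p / 2 = h
    push_cast
    field_simp
  rw [hsum, nome_int, one_mul]
  congr 1
  refine Finset.prod_congr rfl fun j _ ↦ ?_
  have := klein_two_mul_div (p := p) τ j
  push_cast at this
  exact this.symm

/-- Quadratic reciprocity for a prime and an integer of either sign. -/
lemma chi_four_pow_mul_legendreSym {p : ℕ} [Fact p.Prime] (hp : p ≠ 2) {d : ℤ} (hd : Odd d) :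
    ZMod.χ₄ d ^ (p / 2) * legendreSym p d = jacobiSym p d.natAbs := by
  have hodd : Odd p := (Fact.out : p.Prime).odd_of_ne_two hp
  have hn : Odd d.natAbs := Int.natAbs_odd.mpr hd
  have hrec := jacobiSym.quadratic_reciprocity hodd hn
  have hχn := ZMod.χ₄_eq_neg_one_pow (Nat.odd_iff.mp hn)
  have hχp := ZMod.χ₄_eq_neg_one_pow (Nat.odd_iff.mp hodd)
  rw [jacobiSym.legendreSym.to_jacobiSym]
  rcases Int.natAbs_eq d with h | h
  · have : ZMod.χ₄ (d : ZMod 4) = ZMod.χ₄ (d.natAbs : ZMod 4) := by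
      conv_lhs => rw [h]
      rw [Int.cast_natCast]
    rw [this, hχn, hrec, ← pow_mul, mul_comm (p / 2), congrArg (jacobiSym · p) h]
  · have : ZMod.χ₄ (d : ZMod 4) = -ZMod.χ₄ (d.natAbs : ZMod 4) := by
      conv_lhs => rw [h]
      rw [Int.cast_neg, Int.cast_natCast]
      have : ∀ y : ZMod 4, ZMod.χ₄ (-y) = -ZMod.χ₄ y := by decide
      exact this _
    rw [this, hχn, hrec, congrArg (jacobiSym · p) h, jacobiSym.neg _ hodd, hχp, neg_pow, ← pow_mul,
      mul_comm (p / 2) (d.natAbs / 2)]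
    have : ((-1 : ℤ) ^ (p / 2)) * (-1) ^ (p / 2) = 1 := by
      rw [← mul_pow]; norm_num
    linear_combination ((-1) ^ (d.natAbs / 2 * (p / 2)) * jacobiSym (d.natAbs : ℤ) p) * this

lemma odd_of_det {a b c d : ℤ} (hdet : a * d - b * c = 1) (hc : 2 ∣ c) : Odd d := by
  by_contra hne
  rw [Int.not_odd_iff_even] at hne
  have : Even (1 : ℤ) := hdet ▸ ((hne.mul_left a).sub ((even_iff_two_dvd.mpr hc).mul_left b))
  simp at this

lemma eta_mul_odd_prime_moebius {p : ℕ} [Fact p.Prime] (hp : p ≠ 2) {a b c d : ℤ}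
    (hdet : a * d - b * c = 1) (hb : 12 ∣ b) (hc : (24 * p : ℤ) ∣ c) {τ : ℂ} (hτ : 0 < τ.im) :
    ModularForm.eta (p * ((a * τ + b) / (c * τ + d))) * ModularForm.eta τ =
      jacobiSym p d.natAbs * ModularForm.eta ((a * τ + b) / (c * τ + d)) *
        ModularForm.eta (p * τ) := by
  have hodd : Odd p := (Fact.out : p.Prime).odd_of_ne_two hp
  obtain ⟨C, -, hC⟩ := eta_mul_eq_prod_klein hodd
  have hc12 : (12 : ℤ) ∣ c := dvd_trans ⟨2 * p, by ring⟩ hc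
  have hsq := eta_sq_moebius hdet hb hc12 hτ
  have hK := prod_klein_moebius hp hdet hc hτ
  rw [hC _ (im_moebius_pos hdet hτ), hC _ hτ,
    ← chi_four_pow_mul_legendreSym hp (odd_of_det hdet (dvd_trans (by norm_num) hc12))]
  have hpow : ∀ x : ℂ, x ^ p = x * (x ^ 2) ^ (p / 2) := fun x ↦ by
    rw [← pow_mul, ← pow_succ', Nat.two_mul_div_two_add_one_of_odd hodd]
  rw [hpow, hpow, hsq, mul_pow, mul_pow]
  push_cast
  linear_combination (C * ModularForm.eta ((a * τ + b) / (c * τ + d)) * ModularForm.eta τ *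
    (ZMod.χ₄ d : ℂ) ^ (p / 2) * (ModularForm.eta τ ^ 2) ^ (p / 2)) * hK

lemma klein_div_four {d : ℤ} (hd : Odd d) (τ : ℂ) :
    klein (d / 4) τ = (ZMod.χ₈' d : ℂ) * klein (1 / 4) τ := by
  have h : (d : ℂ) = ((d % 8 : ℤ) : ℂ) + 8 * (d / 8 : ℤ) := by
    exact_mod_cast (Int.emod_add_mul_ediv d 8).symm
  have hmod : ZMod.χ₈' (d : ZMod 8) = ZMod.χ₈' ((d % 8 : ℤ) : ZMod 8) := by
    rw [← ZMod.intCast_mod d 8]; rfl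
  rw [h, hmod, show (((d % 8 : ℤ) : ℂ) + 8 * (d / 8 : ℤ)) / 4 =
    ((d % 8 : ℤ) : ℂ) / 4 + 2 * (d / 8 : ℤ) by ring, klein_add_two_mul_int]
  have hcases : d % 8 = 1 ∨ d % 8 = 3 ∨ d % 8 = 5 ∨ d % 8 = 7 := by
    have := Int.odd_iff.mp hd
    omega
  rcases hcases with h | h | h | h <;> rw [h]
  · rw [show ZMod.χ₈' ((1 : ℤ) : ZMod 8) = 1 by decide]
    simp
  · rw [show ZMod.χ₈' ((3 : ℤ) : ZMod 8) = 1 by decide,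
      show ((3 : ℤ) : ℂ) / 4 = -(1 / 4) + 1 by norm_num, klein_add_one, klein_neg]
    simp
  · rw [show ZMod.χ₈' ((5 : ℤ) : ZMod 8) = -1 by decide,
      show ((5 : ℤ) : ℂ) / 4 = 1 / 4 + 1 by norm_num, klein_add_one]
    simp
  · rw [show ZMod.χ₈' ((7 : ℤ) : ZMod 8) = -1 by decide,
      show ((7 : ℤ) : ℂ) / 4 = -(1 / 4) + 2 * (1 : ℤ) by norm_num, klein_add_two_mul_int, klein_neg]
    simp

lemma chi_four_mul_chi_eight' {d : ℤ} (hd : Odd d) :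
    ZMod.χ₄ d * ZMod.χ₈' d = jacobiSym 2 d.natAbs := by
  rw [jacobiSym.at_two (Int.natAbs_odd.mpr hd)]
  have h4 : ZMod.χ₄ (d : ZMod 4) = ZMod.χ₄ ((d % 8 : ℤ) : ZMod 4) := by
    rw [← ZMod.intCast_mod d 4, ← ZMod.intCast_mod (d % 8) 4,
      Int.emod_emod_of_dvd d (by norm_num : ((4 : ℕ) : ℤ) ∣ 8)]
  have h8 : ZMod.χ₈' (d : ZMod 8) = ZMod.χ₈' ((d % 8 : ℤ) : ZMod 8) := by
    rw [← ZMod.intCast_mod d 8]; rfl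
  have hn : ZMod.χ₈ (d.natAbs : ZMod 8) = ZMod.χ₈ ((d % 8 : ℤ) : ZMod 8) := by
    have h2 : ZMod.χ₈ (d : ZMod 8) = ZMod.χ₈ ((d % 8 : ℤ) : ZMod 8) := by
      rw [← ZMod.intCast_mod d 8]; rfl
    rw [← h2]
    rcases Int.natAbs_eq d with h | h
    · conv_rhs => rw [h]
      rw [Int.cast_natCast]
    · conv_rhs => rw [h]
      rw [Int.cast_neg, Int.cast_natCast]
      have : ∀ y : ZMod 8, ZMod.χ₈ (-y) = ZMod.χ₈ y := by decide
      exact (this _).symm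
  have hcases : d % 8 = 1 ∨ d % 8 = 3 ∨ d % 8 = 5 ∨ d % 8 = 7 := by
    have := Int.odd_iff.mp hd
    omega
  rw [h4, h8, hn]
  rcases hcases with h | h | h | h <;> rw [h] <;> decide

lemma eta_two_mul_moebius {a b c d : ℤ} (hdet : a * d - b * c = 1) (hb : 24 ∣ b) (hc : 48 ∣ c)
    {τ : ℂ} (hτ : 0 < τ.im) :
    ModularForm.eta (2 * ((a * τ + b) / (c * τ + d))) * ModularForm.eta τ =
      jacobiSym 2 d.natAbs * ModularForm.eta ((a * τ + b) / (c * τ + d)) *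
        ModularForm.eta (2 * τ) := by
  obtain ⟨C, -, hC⟩ := eta_four_mul_eq
  obtain ⟨b, rfl⟩ := hb
  obtain ⟨c, rfl⟩ := hc
  have hd : Odd d := odd_of_det hdet ⟨24 * c, by ring⟩
  -- the product formula for `η(4 τ)` is applied at `τ / 2`, on which a conjugate matrix acts
  have hdet' : a * d - 12 * b * (96 * c) = 1 := by linarith
  have hτ2 : 0 < (τ / 2).im := by
    simpa [Complex.div_ofNat_im] using hτ
  have hj := denom_ne_zero_of_det hdet' hτ2
  have hK := klein_torsion_moebius hdet' hτ2 four_ne_zero 1 (12 * c) (by push_cast; ring)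
  have hsq := eta_sq_moebius hdet' ⟨b, rfl⟩ ⟨8 * c, by ring⟩ hτ2
  have hj' : (((96 * c : ℤ) : ℂ) * (τ / 2) + d) = ((48 * c : ℤ) : ℂ) * τ + d := by push_cast; ring
  have hm : ((a : ℂ) * (τ / 2) + ((12 * b : ℤ) : ℂ)) / (((96 * c : ℤ) : ℂ) * (τ / 2) + d) =
      ((a * τ + ((24 * b : ℤ) : ℂ)) / (((48 * c : ℤ) : ℂ) * τ + d)) / 2 := by
    rw [hj']; push_cast; ring
  rw [hm, hj'] at hK hsq
  rw [hj'] at hj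
  have h1 := hC _ hτ2
  have h2 := hC _ (hm ▸ im_moebius_pos hdet' hτ2)
  rw [show 4 * (τ / 2) = 2 * τ by ring, show 2 * (τ / 2) = τ by ring] at h1
  generalize (a * τ + ((24 * b : ℤ) : ℂ)) / (((48 * c : ℤ) : ℂ) * τ + d) = z at *
  rw [show 4 * (z / 2) = 2 * z by ring, show 2 * (z / 2) = z by ring] at h2
  have hn : nome (-((1 ^ 2 * (12 * c) * d : ℤ) : ℂ) / (4 : ℕ)) = 1 := by
    rw [← nome_int (-(3 * c * d))]
    congr 1
    push_cast
    ring
  rw [hn, mul_one, Int.cast_one, one_mul, Nat.cast_ofNat, klein_div_four hd] at hK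
  rw [h1, h2, hsq, hK, ← chi_four_mul_chi_eight' hd]
  push_cast at hj ⊢
  field_simp

lemma eta_mul_prime_moebius {p : ℕ} (hp : p.Prime) {a b c d : ℤ}
    (hdet : a * d - b * c = 1) (hb : 24 ∣ b) (hc : (24 * p : ℤ) ∣ c) {τ : ℂ} (hτ : 0 < τ.im) :
    ModularForm.eta (p * ((a * τ + b) / (c * τ + d))) * ModularForm.eta τ =
      jacobiSym p d.natAbs * ModularForm.eta ((a * τ + b) / (c * τ + d)) *
        ModularForm.eta (p * τ) := by
  have := Fact.mk hp
  rcases eq_or_ne p 2 with rfl | h2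
  · exact_mod_cast eta_two_mul_moebius hdet hb (by simpa using hc) hτ
  · exact eta_mul_odd_prime_moebius h2 hdet (dvd_trans (by norm_num) hb) hc hτ

/-- The function `η(n τ) / η(τ)` transforms with the quadratic character `(n / |d|)` on the matrices
with `24 ∣ b` and `24 n ∣ c`. -/
theorem eta_mul_nat_moebius {n : ℕ} (hn : n ≠ 0) {a b c d : ℤ}
    (hdet : a * d - b * c = 1) (hb : 24 ∣ b) (hc : (24 * n : ℤ) ∣ c) {τ : ℂ} (hτ : 0 < τ.im) :
    ModularForm.eta (n * ((a * τ + b) / (c * τ + d))) * ModularForm.eta τ =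
      jacobiSym n d.natAbs * ModularForm.eta ((a * τ + b) / (c * τ + d)) *
        ModularForm.eta (n * τ) := by
  induction n using induction_on_primes generalizing a b c d τ with
  | zero => exact absurd rfl hn
  | one => simp [mul_comm]
  | prime_mul p n hp ih =>
    have hn0 : n ≠ 0 := fun h ↦ hn (by rw [h, mul_zero])
    have hnC : (n : ℂ) ≠ 0 := by exact_mod_cast hn0
    obtain ⟨m, rfl⟩ := hc
    have hih := ih hn0 hdet hb ⟨p * m, by push_cast; ring⟩ hτ
    have hnτ := im_natCast_mul_pos hτ (Nat.pos_of_ne_zero hn0)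
    -- `n γ τ = γ' (n τ)` for the conjugate `γ'` of `γ` by the diagonal matrix `(n, 1)`
    have hp' := eta_mul_prime_moebius (a := a) (b := n * b) (c := 24 * p * m) (d := d) hp
      (by rw [← hdet]; push_cast; ring) (hb.mul_left _) ⟨m, by ring⟩ hnτ
    have hz : ((a : ℂ) * (n * τ) + ((n * b : ℤ) : ℂ)) / (((24 * p * m : ℤ) : ℂ) * (n * τ) + d) =
        n * ((a * τ + b) / (((24 * ((p * n : ℕ) : ℤ) * m : ℤ) : ℂ) * τ + d)) := by
      push_cast
      ring
    rw [hz] at hp'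
    generalize (a * τ + b) / (((24 * ((p * n : ℕ) : ℤ) * m : ℤ) : ℂ) * τ + d) = z at *
    have hne := ModularForm.eta_ne_zero hnτ
    refine mul_right_cancel₀ hne ?_
    rw [Nat.cast_mul, Nat.cast_mul, jacobiSym.mul_left, mul_assoc (p : ℂ), mul_assoc (p : ℂ)]
    push_cast at hp' hih ⊢
    linear_combination ModularForm.eta τ * hp' +
      (jacobiSym p d.natAbs : ℂ) * ModularForm.eta (p * (n * τ)) * hih

/-! ### The Kronecker symbol as a Dirichlet character -/

lemma kroneckerSym_of_odd (n : ℤ) {d : ℤ} (hd : Odd d) :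
    kroneckerSym n d = (if n < 0 ∧ d < 0 then -1 else 1) * jacobiSym n d.natAbs := by
  have hd0 : d ≠ 0 := fun h ↦ by simp [h] at hd
  have h2 : padicValNat 2 d.natAbs = 0 :=
    padicValNat.eq_zero_of_not_dvd (Int.natAbs_odd.mpr hd).not_two_dvd_nat
  rw [kroneckerSym, if_neg hd0, h2, pow_zero, pow_zero, mul_one, Nat.div_one]

lemma jacobiSym_mod {n : ℤ} {N : ℕ} (hN : 4 * n.natAbs ∣ N) {b : ℕ} (hb : Odd b) :
    jacobiSym n (b % N) = jacobiSym n b := by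
  have hb' : Odd (b % N) := by
    have h2 : 2 ∣ N := dvd_trans ⟨2 * n.natAbs, by ring⟩ hN
    rwa [Nat.odd_iff, Nat.mod_mod_of_dvd _ h2, ← Nat.odd_iff]
  rw [jacobiSym.mod_right n hb', jacobiSym.mod_right n hb, Nat.mod_mod_of_dvd _ hN]

/-- The value at `-1` of the character `d ↦ (n / d)` is the sign of `n`; it is computed modulo
`4 |n|` from `4 |n| ≡ 1` modulo `4 |n| - 1`. -/
lemma jacobiSym_sub_one {n : ℤ} (hn : n ≠ 0) {N : ℕ} (hN : 4 * n.natAbs ∣ N) (hN0 : N ≠ 0) :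
    jacobiSym n (N - 1) = if n < 0 then -1 else 1 := by
  have hm : 0 < n.natAbs := Int.natAbs_pos.mpr hn
  have hNodd : Odd (N - 1) := by
    obtain ⟨t, rfl⟩ := hN
    rw [Nat.odd_iff]
    have : 0 < n.natAbs * t := Nat.pos_of_ne_zero fun h ↦ hN0 (by rw [mul_assoc, h, mul_zero])
    rw [mul_assoc]
    omega
  have hodd : Odd (4 * n.natAbs - 1) := by
    rw [Nat.odd_iff]; omega
  have hred : jacobiSym n (N - 1) = jacobiSym n (4 * n.natAbs - 1) := by
    rw [jacobiSym.mod_right n hNodd]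
    congr 1
    obtain ⟨t, rfl⟩ := hN
    obtain ⟨s, rfl⟩ : ∃ s, t = s + 1 := Nat.exists_eq_succ_of_ne_zero fun h ↦ hN0 (by rw [h, mul_zero])
    rw [mul_add, mul_one, Nat.add_sub_assoc (by omega), Nat.mul_add_mod]
    exact Nat.mod_eq_of_lt (by omega)
  have habs : jacobiSym (n.natAbs : ℤ) (4 * n.natAbs - 1) = 1 := by
    have h4 : jacobiSym (4 * (n.natAbs : ℤ)) (4 * n.natAbs - 1) = 1 := by
      rw [← jacobiSym.one_left (4 * n.natAbs - 1)]
      refine jacobiSym.mod_left' (Int.emod_eq_emod_iff_emod_sub_eq_zero.mpr ?_)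
      rw [Nat.cast_sub (by omega)]
      push_cast
      exact Int.emod_self
    rwa [jacobiSym.mul_left, jacobiSym.at_four hodd, one_mul] at h4
  rw [hred]
  rcases Int.natAbs_eq n with h | h
  · rw [if_neg (by omega), congrArg (jacobiSym · _) h]
    exact habs
  · rw [if_pos (by omega), congrArg (jacobiSym · _) h]
    change jacobiSym (-(n.natAbs : ℤ)) _ = -1
    rw [jacobiSym.neg _ hodd, habs, mul_one, ZMod.χ₄_nat_three_mod_four (by omega)]

lemma kroneckerSym_eq_jacobiSym_emod {n : ℤ} (hn : n ≠ 0) {N : ℕ} (hN : 4 * n.natAbs ∣ N)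
    (hN0 : N ≠ 0) {d : ℤ} (hd : Odd d) : kroneckerSym n d = jacobiSym n (d % N).toNat := by
  have hdn : Odd d.natAbs := Int.natAbs_odd.mpr hd
  have hd0 : d.natAbs ≠ 0 := fun h ↦ by simp [h] at hdn
  rw [kroneckerSym_of_odd n hd]
  rcases Int.natAbs_eq d with h | h
  · rw [if_neg (by omega), one_mul, ← jacobiSym_mod hN hdn]
    congr 1
    conv_rhs => rw [h]
    norm_cast
  · have hN2 : 1 ≤ N - 1 := by
      have := Nat.le_of_dvd (Nat.pos_of_ne_zero hN0) hN
      have := Int.natAbs_pos.mpr hn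
      omega
    have hNodd : Odd (N - 1) := by
      obtain ⟨t, ht⟩ : 2 ∣ N := dvd_trans ⟨2 * n.natAbs, by ring⟩ hN
      rw [Nat.odd_iff]; omega
    have : NeZero (N - 1) := ⟨by omega⟩
    have : NeZero d.natAbs := ⟨hd0⟩
    -- `-e` is congruent to `e (N - 1)` modulo `N`
    have hmod : (d % N).toNat = (d.natAbs * (N - 1)) % N := by
      have : (d % N) = ((d.natAbs * (N - 1) % N : ℕ) : ℤ) := by
        rw [Int.natCast_mod, Nat.cast_mul, Nat.cast_sub (Nat.one_le_iff_ne_zero.mpr hN0),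
          Int.emod_eq_emod_iff_emod_sub_eq_zero]
        refine Int.emod_eq_zero_of_dvd ⟨-d.natAbs, ?_⟩
        rw [Nat.cast_one]
        linear_combination h
      rw [this, Int.toNat_natCast]
    rw [hmod, jacobiSym_mod hN (hdn.mul hNodd), jacobiSym.mul_right, jacobiSym_sub_one hn hN hN0,
      mul_comm]
    congr 1
    have : d < 0 := by omega
    simp [this]

/-- The Kronecker symbol `d ↦ (n / d)` as a Dirichlet character modulo a multiple of `4 |n|`. -/
noncomputable def kroneckerChar {n : ℤ} {N : ℕ} (hN : 4 * n.natAbs ∣ N) (hN0 : N ≠ 0) :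
    DirichletCharacter ℂ N :=
  have : NeZero N := ⟨hN0⟩
  have hodd : ∀ {x : ZMod N}, IsUnit x → Odd x.val := fun {x} hx ↦ by
    have h1 := (ZMod.isUnit_iff_coprime x.val N).mp (by rwa [ZMod.natCast_zmod_val])
    have h2 : 2 ∣ N := dvd_trans ⟨2 * n.natAbs, by ring⟩ hN
    exact Nat.coprime_two_right.mp (h1.coprime_dvd_right h2)
  open Classical in
  { toFun := fun x ↦ if IsUnit x then (jacobiSym n x.val : ℂ) else 0
    map_one' := by
      have h1 := jacobiSym_mod hN odd_one
      rw [jacobiSym.one_right] at h1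
      rw [if_pos isUnit_one, ← Nat.cast_one, ZMod.val_natCast, h1, Int.cast_one]
    map_mul' := fun x y ↦ by
      by_cases hx : IsUnit x
      · by_cases hy : IsUnit y
        · have : NeZero x.val := ⟨(hodd hx).pos.ne'⟩
          have : NeZero y.val := ⟨(hodd hy).pos.ne'⟩
          rw [if_pos (hx.mul hy), if_pos hx, if_pos hy, ZMod.val_mul,
            jacobiSym_mod hN ((hodd hx).mul (hodd hy)), jacobiSym.mul_right]
          push_cast
          rfl
        · rw [if_neg (fun h ↦ hy (isUnit_of_mul_isUnit_right h)), if_neg hy, mul_zero]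
      · rw [if_neg (fun h ↦ hx (isUnit_of_mul_isUnit_left h)), if_neg hx, zero_mul]
    map_nonunit' := fun x hx ↦ if_neg hx }

lemma kroneckerChar_apply {n : ℤ} (hn : n ≠ 0) {N : ℕ} (hN : 4 * n.natAbs ∣ N) (hN0 : N ≠ 0)
    {d : ℤ} (hd : IsCoprime d N) :
    kroneckerChar hN hN0 (d : ZMod N) = (kroneckerSym n d : ℂ) := by
  have : NeZero N := ⟨hN0⟩
  have hu : IsUnit (d : ZMod N) := (ZMod.coe_int_isUnit_iff_isCoprime d N).mpr hd.symm
  have hodd : Odd d := by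
    have h2 : (2 : ℤ) ∣ N := by
      exact_mod_cast dvd_trans (⟨2 * n.natAbs, by ring⟩ : 2 ∣ 4 * n.natAbs) hN
    exact Int.isCoprime_two_right.mp (hd.of_isCoprime_of_dvd_right h2)
  have hv : (d : ZMod N).val = (d % N).toNat := by
    rw [← ZMod.val_intCast, Int.toNat_natCast]
  change (if IsUnit (d : ZMod N) then (jacobiSym n (d : ZMod N).val : ℂ) else 0) = _
  rw [if_pos hu, hv, kroneckerSym_eq_jacobiSym_emod hn hN hN0 hodd]

lemma kroneckerSym_neg_one_pow_mul {n : ℕ} (hn : n ≠ 0) (k : ℕ) {d : ℤ} (hd : Odd d) :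
    kroneckerSym ((-1) ^ k * n) d = ZMod.χ₄ d ^ k * jacobiSym n d.natAbs := by
  have hdn : Odd d.natAbs := Int.natAbs_odd.mpr hd
  have hn' : (0 : ℤ) < n := by exact_mod_cast Nat.pos_of_ne_zero hn
  rw [kroneckerSym_of_odd _ hd, jacobiSym.mul_left, jacobiSym.pow_left, jacobiSym.at_neg_one hdn,
    ← mul_assoc]
  congr 1
  rcases Int.natAbs_eq d with h | h
  · have : ZMod.χ₄ (d : ZMod 4) = ZMod.χ₄ (d.natAbs : ZMod 4) := by
      conv_lhs => rw [h]
      rw [Int.cast_natCast]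
    rw [if_neg (by omega), one_mul, this]
  · have : ZMod.χ₄ (d : ZMod 4) = -ZMod.χ₄ (d.natAbs : ZMod 4) := by
      conv_lhs => rw [h]
      rw [Int.cast_neg, Int.cast_natCast]
      have : ∀ y : ZMod 4, ZMod.χ₄ (-y) = -ZMod.χ₄ y := by decide
      exact this _
    have hneg : d < 0 := by
      have := Nat.pos_of_ne_zero (fun h0 ↦ by simp [h0] at hdn : d.natAbs ≠ 0)
      omega
    rw [this]
    rcases Nat.even_or_odd k with hk | hk
    · rw [hk.neg_one_pow, if_neg (by rw [one_mul]; omega), hk.neg_pow, one_mul]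
    · rw [hk.neg_one_pow, if_pos ⟨by linarith, hneg⟩, hk.neg_pow, neg_one_mul]

/-! ### The transformation of the eta quotient under `Γ₀(576 a c)` -/

lemma eta_mul_nat_sq_moebius {n : ℕ} (hn : n ≠ 0) {a b c d : ℤ}
    (hdet : a * d - b * c = 1) (hb : 12 ∣ b) (hc : (12 * n : ℤ) ∣ c) {τ : ℂ} (hτ : 0 < τ.im) :
    ModularForm.eta (n * ((a * τ + b) / (c * τ + d))) ^ 2 =
      (ZMod.χ₄ d : ℂ) * (c * τ + d) * ModularForm.eta (n * τ) ^ 2 := by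
  obtain ⟨m, rfl⟩ := hc
  have h := eta_sq_moebius (a := a) (b := n * b) (c := 12 * m) (d := d)
    (by rw [← hdet]; ring) (hb.mul_left _) ⟨m, rfl⟩ (im_natCast_mul_pos hτ (Nat.pos_of_ne_zero hn))
  have e1 : ((a : ℂ) * (n * τ) + ((n * b : ℤ) : ℂ)) / (((12 * m : ℤ) : ℂ) * (n * τ) + d) =
      n * ((a * τ + b) / (((12 * n * m : ℤ) : ℂ) * τ + d)) := by
    push_cast
    ring
  rw [e1] at h
  rw [h]
  push_cast
  ring

lemma F_eq (a b c : ℕ) (τ : ℍ) : F a b c τ =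
    ModularForm.eta ((a : ℕ) * (24 * τ)) ^ a *
      ModularForm.eta ((a * c : ℕ) * (24 * τ)) ^ ((b : ℤ) - a) / ModularForm.eta (24 * τ) := by
  rw [F]
  push_cast
  ring_nf

lemma zpow_two_mul_of_sq {x y u : ℂ} (h : x ^ 2 = u * y ^ 2) (t : ℤ) :
    x ^ (2 * t) = u ^ t * y ^ (2 * t) := by
  rw [zpow_mul, zpow_mul, zpow_ofNat, zpow_ofNat, h, mul_zpow]

lemma chi_four_ne_zero {d : ℤ} (hd : Odd d) : (ZMod.χ₄ d : ℂ) ≠ 0 := by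
  have : ZMod.χ₄ d ≠ 0 := by
    rw [ZMod.χ₄_int_eq_if_mod_four, if_neg (by rw [Int.odd_iff.mp hd]; decide)]
    split_ifs <;> decide
  exact_mod_cast this

lemma F_smul {a b c k : ℕ} (ha : a ≠ 0) (hc : c ≠ 0) (hb : b = 2 * k + 1) {γ : SL(2, ℤ)}
    (hγ : γ ∈ Gamma0 (576 * a * c)) (τ : ℍ) :
    F a b c (γ • τ) = (ZMod.χ₄ (γ 1 1 : ℤ) : ℂ) ^ k *
      jacobiSym (if Even a then (a * c : ℕ) else a : ℕ) (γ 1 1).natAbs *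
        (γ 1 0 * τ + γ 1 1 : ℂ) ^ k * F a b c τ := by
  have hac : a * c ≠ 0 := mul_ne_zero ha hc
  have hdet : γ 0 0 * γ 1 1 - γ 0 1 * γ 1 0 = 1 := by
    have := Matrix.SpecialLinearGroup.det_coe γ
    rwa [Matrix.det_fin_two] at this
  obtain ⟨m, hm⟩ := (ZMod.intCast_zmod_eq_zero_iff_dvd _ _).mp (Gamma0_mem.mp hγ)
  rw [F_eq, F_eq, coe_smul_eq]
  generalize γ 0 0 = A at *
  generalize γ 0 1 = B at *
  generalize γ 1 0 = C at *
  generalize γ 1 1 = D at *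
  have h24 : 0 < (24 * (τ : ℂ)).im := by simpa using τ.im_pos
  -- `24 γ τ` is the image of `24 τ` under the conjugated matrix `(A, 24 B; C / 24, D)`
  have hdet' : A * D - 24 * B * (24 * (a * c) * m) = 1 := by
    rw [← hdet, hm]; push_cast; ring
  have hj := denom_ne_zero_of_det hdet' h24
  have hB24 : (24 : ℤ) ∣ 24 * B := ⟨B, rfl⟩
  have hB12 : (12 : ℤ) ∣ 24 * B := ⟨2 * B, by ring⟩
  have sa := eta_mul_nat_sq_moebius ha hdet' hB12 ⟨2 * (c * m), by ring⟩ h24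
  have sac := eta_mul_nat_sq_moebius hac hdet' hB12 ⟨2 * m, by push_cast; ring⟩ h24
  have ga := eta_mul_nat_moebius ha hdet' hB24 ⟨c * m, by ring⟩ h24
  have gac := eta_mul_nat_moebius hac hdet' hB24 ⟨m, by push_cast; ring⟩ h24
  have hz0 := im_moebius_pos hdet' h24
  have hjj : (((24 * (a * c) * m : ℤ) : ℂ) * (24 * τ) + D) = C * τ + D := by
    rw [hm]; push_cast; ring
  have hz : ((A : ℂ) * (24 * τ) + ((24 * B : ℤ) : ℂ)) / (C * τ + D) =
      24 * ((A * τ + B) / (C * τ + D)) := by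
    push_cast
    ring
  rw [hjj] at sa sac hj ga gac hz0
  rw [hz] at sa sac ga gac hz0
  have hχ := chi_four_ne_zero (odd_of_det hdet' ⟨12 * (a * c) * m, by ring⟩)
  have n1 := ModularForm.eta_ne_zero h24
  have n2 := ModularForm.eta_ne_zero hz0
  have n3 := ModularForm.eta_ne_zero (im_natCast_mul_pos hz0 (Nat.pos_of_ne_zero hac))
  have n4 := ModularForm.eta_ne_zero (im_natCast_mul_pos h24 (Nat.pos_of_ne_zero hac))
  rw [show ∀ x J y R : ℂ, x ^ k * J * y ^ k * R = (x * y) ^ k * (J * R) by intros; ring]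
  have hu := mul_ne_zero hχ hj
  set u : ℂ := (ZMod.χ₄ D : ℂ) * (C * τ + D)
  set z : ℂ := 24 * ((A * τ + B) / (C * τ + D))
  set w : ℂ := 24 * (τ : ℂ)
  have hcomb : ∀ s : ℤ, u ^ s * u ^ ((k : ℤ) - s) = u ^ k := fun s ↦ by
    rw [← zpow_add₀ hu, add_sub_cancel, zpow_natCast]
  have hdiv : ∀ {x y J : ℂ}, x * ModularForm.eta w = J * ModularForm.eta z * y →
      x / ModularForm.eta z = J * (y / ModularForm.eta w) := fun {x y J} h ↦ by
    rw [div_eq_iff n2, ← mul_div_assoc, div_mul_eq_mul_div, eq_div_iff n1, h]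
    ring
  have ga' := hdiv ga
  have gac' := hdiv gac
  rcases Nat.even_or_odd' a with ⟨s, hs | hs⟩
  · rw [if_pos ⟨s, by omega⟩]
    have e : (b : ℤ) - a = 2 * ((k : ℤ) - s) + 1 := by rw [hb, hs]; push_cast; ring
    have e2 : (a : ℤ) = 2 * (s : ℤ) := by exact_mod_cast hs
    rw [e, zpow_add₀ n3, zpow_add₀ n4, zpow_one, zpow_one, zpow_two_mul_of_sq sac, ← zpow_natCast _ a,
      ← zpow_natCast _ a, e2, zpow_two_mul_of_sq sa, ← hcomb s]
    linear_combination (u ^ (s : ℤ) * ModularForm.eta (a * w) ^ (2 * (s : ℤ)) * (u ^ ((k : ℤ) - s) *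
      ModularForm.eta ((a * c : ℕ) * w) ^ (2 * ((k : ℤ) - s)))) * gac'
  · have hodd : ¬ Even a := Nat.not_even_iff_odd.mpr ⟨s, hs⟩
    rw [if_neg hodd]
    have e : (b : ℤ) - a = 2 * ((k : ℤ) - s) := by rw [hb, hs]; push_cast; ring
    have hpow : ∀ x : ℂ, x ^ a = x ^ (2 * (s : ℤ)) * x := fun x ↦ by
      rw [hs, pow_succ]
      norm_cast
    rw [e, zpow_two_mul_of_sq sac, hpow, hpow, zpow_two_mul_of_sq sa, ← hcomb s]
    linear_combination (u ^ (s : ℤ) * ModularForm.eta (a * w) ^ (2 * (s : ℤ)) * (u ^ ((k : ℤ) - s) *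
      ModularForm.eta ((a * c : ℕ) * w) ^ (2 * ((k : ℤ) - s)))) * ga'

lemma mdifferentiable_F (a b c : ℕ) (ha : a ≠ 0) (hc : c ≠ 0) : MDiff (F a b c) := by
  have hac : a * c ≠ 0 := mul_ne_zero ha hc
  rw [UpperHalfPlane.mdifferentiable_iff]
  have h24 : ∀ {z : ℂ}, 0 < z.im → 0 < (24 * z).im := fun {z} hz ↦ by simpa using hz
  have hη : ∀ n : ℕ, n ≠ 0 → ∀ z : ℂ, 0 < z.im →
      DifferentiableAt ℂ (fun z ↦ ModularForm.eta (n * (24 * z))) z := fun n hn z hz ↦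
    DifferentiableAt.comp z (g := ModularForm.eta) (f := fun z : ℂ ↦ (n : ℂ) * (24 * z))
      (ModularForm.differentiableAt_eta_of_mem_upperHalfPlaneSet
        (im_natCast_mul_pos (h24 hz) (Nat.pos_of_ne_zero hn))) (by fun_prop)
  have hd : ∀ z : ℂ, 0 < z.im → DifferentiableAt ℂ (fun z ↦
      ModularForm.eta ((a : ℕ) * (24 * z)) ^ a *
      ModularForm.eta ((a * c : ℕ) * (24 * z)) ^ ((b : ℤ) - a) / ModularForm.eta (24 * z)) z :=
    fun z hz ↦ by
      have h1 := hη 1 one_ne_zero z hz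
      simp only [Nat.cast_one, one_mul] at h1
      exact (((hη a ha z hz).pow a).mul ((hη (a * c) hac z hz).zpow (.inl (ModularForm.eta_ne_zero
        (im_natCast_mul_pos (h24 hz) (Nat.pos_of_ne_zero hac)))))).div h1
          (ModularForm.eta_ne_zero (h24 hz))
  refine DifferentiableOn.congr (fun z hz ↦ (hd z hz).differentiableWithinAt) fun z hz ↦ ?_
  rw [Function.comp_apply, F_eq, ofComplex_apply_of_im_pos hz]

/-- The character of the eta quotient, as a Kronecker symbol, and the transformation law. -/
theorem isHolomorphicNebentypus_F {a b c k : ℕ} (ha : a ≠ 0) (hc : c ≠ 0) (hb : b = 2 * k + 1) :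
    ∃ χ : DirichletCharacter ℂ (576 * a * c),
      (∀ d : ℤ, IsCoprime d ((576 * a * c : ℕ) : ℤ) →
        χ (d : ZMod (576 * a * c)) =
          ((EtaQuotient.kroneckerSym
            (if Even a then (-1) ^ k * ((a : ℤ) * (c : ℤ)) else (-1) ^ k * (a : ℤ)) d : ℤ) : ℂ)) ∧
      IsHolomorphicNebentypus (576 * a * c) k χ (F a b c) := by
  have hac : a * c ≠ 0 := mul_ne_zero ha hc
  have hN0 : 576 * a * c ≠ 0 := by rw [mul_assoc]; exact mul_ne_zero (by norm_num) hac
  set n : ℕ := if Even a then (a * c : ℕ) else a with hn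
  have hn0 : n ≠ 0 := by rw [hn]; split_ifs <;> assumption
  have hnn : (if Even a then (-1) ^ k * ((a : ℤ) * (c : ℤ)) else (-1) ^ k * (a : ℤ)) =
      (-1) ^ k * (n : ℤ) := by
    rw [hn]; split_ifs <;> push_cast <;> rfl
  have hnac : n ∣ a * c := by
    rw [hn]; split_ifs
    · exact dvd_rfl
    · exact Dvd.intro _ rfl
  have habs : ((-1) ^ k * (n : ℤ)).natAbs = n := by
    rw [Int.natAbs_mul, Int.natAbs_pow]; simp
  have hdvd : 4 * ((-1) ^ k * (n : ℤ)).natAbs ∣ 576 * a * c := by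
    rw [habs, mul_assoc]
    exact mul_dvd_mul (by norm_num) hnac
  have hD0 : (-1) ^ k * (n : ℤ) ≠ 0 := by
    rw [← Int.natAbs_ne_zero, habs]; exact hn0
  rw [hnn]
  refine ⟨kroneckerChar hdvd hN0, fun d hd ↦ kroneckerChar_apply hD0 hdvd hN0 hd,
    mdifferentiable_F a b c ha hc, fun γ hγ ↦ ?_⟩
  have hdet : γ 0 0 * γ 1 1 - γ 0 1 * γ 1 0 = 1 := by
    have := Matrix.SpecialLinearGroup.det_coe γ
    rwa [Matrix.det_fin_two] at this
  obtain ⟨m, hm⟩ := (ZMod.intCast_zmod_eq_zero_iff_dvd _ _).mp (Gamma0_mem.mp hγ)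
  have hcop : IsCoprime (γ 1 1) ((576 * a * c : ℕ) : ℤ) :=
    ⟨γ 0 0, -(γ 0 1 * m), by linear_combination hdet + γ 0 1 * hm⟩
  have hodd : Odd (γ 1 1) := odd_of_det hdet (by
    rw [hm]; exact ⟨288 * a * c * m, by push_cast; ring⟩)
  funext τ
  have hj : (γ 1 0 * τ + γ 1 1 : ℂ) ≠ 0 := denom_ne_zero_of_det hdet τ.im_pos
  rw [slash_apply_eq, F_smul ha hc hb hγ, ← hn, kroneckerChar_apply hD0 hdvd hN0 hcop,
    kroneckerSym_neg_one_pow_mul hn0 k hodd, zpow_neg, zpow_natCast, Pi.smul_apply, smul_eq_mul,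
    Int.cast_mul, Int.cast_pow]
  field_simp

open Filter Topology

/-! ### Growth of the eta quotient at the cusps -/

lemma tendsto_im_atImInfty : Tendsto (fun τ : ℍ ↦ τ.im) atImInfty atTop := tendsto_comap

lemma continuousAt_tprod_one_sub_pow :
    Tendsto (fun q : ℂ ↦ ∏' n : ℕ, (1 - q ^ (n + 1))) (𝓝 0) (𝓝 1) := by
  have h := (ModularForm.differentiableOn_tprod_one_sub_pow.differentiableAt
    (Metric.ball_mem_nhds (0 : ℂ) one_pos)).continuousAt.tendsto
  simpa using h

lemma tendsto_norm_eta_sq {r : ℝ} (hr : 0 < r) {φ : ℍ → ℂ} (hφ : ∀ τ, (φ τ).im = r * τ.im) :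
    Tendsto (fun τ : ℍ ↦ ‖ModularForm.eta (φ τ)‖ ^ 2 * Real.exp (Real.pi * r / 6 * τ.im))
      atImInfty (𝓝 1) := by
  have hq : Tendsto (fun τ ↦ nome (φ τ)) atImInfty (𝓝 0) := by
    rw [tendsto_zero_iff_norm_tendsto_zero]
    simp only [norm_nome, hφ]
    refine Real.tendsto_exp_atBot.comp ?_
    have : Tendsto (fun τ : ℍ ↦ 2 * Real.pi * r * τ.im) atImInfty atTop :=
      tendsto_im_atImInfty.const_mul_atTop (by positivity)
    refine (tendsto_neg_atTop_atBot.comp this).congr fun τ ↦ ?_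
    simp only [Function.comp_apply]
    ring
  have h := ((continuousAt_tprod_one_sub_pow.comp hq).norm).pow 2
  rw [norm_one, one_pow] at h
  refine h.congr fun τ ↦ ?_
  rw [Function.comp_apply, eta_eq, qPoch_nome_self, norm_mul, norm_nome, mul_pow, ← Real.exp_nat_mul,
    mul_right_comm, ← Real.exp_add, Complex.div_ofNat_im, hφ]
  rw [show ((2 : ℕ) : ℝ) * (-2 * Real.pi * (r * τ.im / 24)) + Real.pi * r / 6 * τ.im = 0 by
    push_cast; ring, Real.exp_zero, one_mul]

lemma norm_eta_moebius_sq {a b c d : ℤ} (hdet : a * d - b * c = 1) {τ : ℂ} (hτ : 0 < τ.im) :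
    ‖ModularForm.eta ((a * τ + b) / (c * τ + d))‖ ^ 2 =
      ‖(c * τ + d : ℂ)‖ * ‖ModularForm.eta τ‖ ^ 2 := by
  have h6 := eta_pow_slash (s := 3) (N := 4) (σ := 1) (by norm_num)
    (by
      have := stdAddChar_four 1
      rw [Nat.cast_one] at this
      rw [this, neg_pow, Complex.I_pow_three]; ring)
    etaExponent_mod_four hdet hτ
  have h := congrArg norm h6
  rw [norm_mul, norm_mul, ZMod.stdAddChar_apply, Circle.norm_coe, one_mul, norm_pow, norm_pow,
    norm_pow, pow_mul, pow_mul, ← mul_pow] at h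
  exact (pow_left_inj₀ (by positivity) (by positivity) (by norm_num)).mp h

/-- Hermite normal form of `(δ A, δ B; C, D)`: an element of `SL(2, ℤ)` times an upper triangular
matrix whose upper left entry is `gcd(C, δ)`. -/
lemma exists_moebius_mul_eq {A B C D : ℤ} (hdet : A * D - B * C = 1) {δ : ℕ} (hδ : δ ≠ 0) :
    ∃ p q r s y : ℤ, ∃ w : ℕ, p * s - q * r = 1 ∧ w ≠ 0 ∧ Int.gcd C δ * w = δ ∧
      δ * A = p * Int.gcd C δ ∧ δ * B = p * y + q * w ∧ C = r * Int.gcd C δ ∧ D = r * y + s * w := by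
  set x : ℕ := Int.gcd C δ with hx
  have hx0 : x ≠ 0 := fun h ↦ hδ (by
    have := (Int.gcd_eq_zero_iff.mp (hx ▸ h)).2
    exact_mod_cast this)
  obtain ⟨r, hr⟩ : (x : ℤ) ∣ C := Int.gcd_dvd_left ..
  obtain ⟨w, hw⟩ : x ∣ δ := by exact_mod_cast (Int.gcd_dvd_right .. : (x : ℤ) ∣ δ)
  have hw0 : w ≠ 0 := fun h ↦ hδ (by rw [hw, h, mul_zero])
  have hxz : (x : ℤ) ≠ 0 := by exact_mod_cast hx0
  have hwr : IsCoprime (w : ℤ) r := by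
    have h1 := Int.gcd_eq_gcd_ab C δ
    rw [← hx] at h1
    refine ⟨Int.gcdB C δ, Int.gcdA C δ, mul_left_cancel₀ hxz ?_⟩
    have hw' : (δ : ℤ) = x * w := by exact_mod_cast hw
    generalize Int.gcdA C δ = g1 at *
    generalize Int.gcdB C δ = g2 at *
    linear_combination -h1 - g1 * hr - g2 * hw'
  have hAr : IsCoprime A r := ⟨D, -(B * x), by linear_combination hdet + B * hr⟩
  obtain ⟨s, t, hst⟩ := hwr.mul_left hAr
  have hw' : (δ : ℤ) = x * w := by exact_mod_cast hw
  refine ⟨w * A, -t, r, s, s * δ * B + t * D, w, by linear_combination hst, hw0, hw.symm, ?_, ?_,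
    by linear_combination hr, ?_⟩
  · rw [hw']; ring
  · linear_combination (-(δ : ℤ) * B) * hst - t * w * hdet - t * w * B * hr + t * B * r * hw'
  · linear_combination -D * hst + s * w * hdet + s * w * B * hr - r * s * B * hw'

/-- The growth of `η(δ γ τ)`: its order at the cusp `γ ∞` is governed by `gcd(C, δ) ^ 2 / δ`. -/
lemma tendsto_norm_eta_smul (γ : SL(2, ℤ)) {δ : ℕ} (hδ : δ ≠ 0) : ∃ K : ℝ, 0 < K ∧
    Tendsto (fun τ : ℍ ↦ ‖ModularForm.eta (δ * (γ • τ : ℍ))‖ ^ 2 / ‖(γ 1 0 * τ + γ 1 1 : ℂ)‖ *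
      Real.exp (Real.pi * ((Int.gcd (γ 1 0) δ : ℝ) ^ 2 / δ) / 6 * τ.im)) atImInfty (𝓝 K) := by
  have hdet : γ 0 0 * γ 1 1 - γ 0 1 * γ 1 0 = 1 := by
    have := Matrix.SpecialLinearGroup.det_coe γ
    rwa [Matrix.det_fin_two] at this
  obtain ⟨p, q, r, s, y, w, h1, hw0, hxw, e1, e2, e3, e4⟩ := exists_moebius_mul_eq hdet hδ
  set x : ℕ := Int.gcd (γ 1 0) δ with hx
  have hx0 : x ≠ 0 := fun h ↦ hδ (by rw [← hxw, h, zero_mul])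
  have hwR : (0 : ℝ) < w := by exact_mod_cast Nat.pos_of_ne_zero hw0
  have hxR : (0 : ℝ) < x := by exact_mod_cast Nat.pos_of_ne_zero hx0
  have hwC : (w : ℂ) ≠ 0 := by exact_mod_cast hw0
  have hδR : (δ : ℝ) = x * w := by exact_mod_cast hxw.symm
  set φ : ℍ → ℂ := fun τ ↦ (x * τ + y) / w with hφ
  have him : ∀ τ, (φ τ).im = (x : ℝ) ^ 2 / δ * τ.im := fun τ ↦ by
    have : φ τ = ((w⁻¹ : ℝ) : ℂ) * (((x : ℝ) : ℂ) * τ + ((y : ℝ) : ℂ)) := by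
      rw [hφ]; push_cast; field_simp
    rw [this, Complex.im_ofReal_mul, Complex.add_im, Complex.im_ofReal_mul, Complex.ofReal_im,
      hδR, add_zero, coe_im]
    field_simp
  have hpos : ∀ τ, 0 < (φ τ).im := fun τ ↦ by
    rw [him]
    have := τ.im_pos
    rw [hδR]
    positivity
  refine ⟨(w : ℝ)⁻¹, inv_pos.mpr hwR, ?_⟩
  have hmain := (tendsto_norm_eta_sq (r := (x : ℝ) ^ 2 / δ) (by rw [hδR]; positivity) him).const_mul
    (w : ℝ)⁻¹
  rw [mul_one] at hmain
  refine hmain.congr fun τ ↦ ?_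
  have hj : (γ 1 0 * τ + γ 1 1 : ℂ) ≠ 0 := denom_ne_zero_of_det hdet τ.im_pos
  have hjr := denom_ne_zero_of_det h1 (hpos τ)
  have c1 : (δ * γ 0 0 : ℂ) = p * x := by exact_mod_cast congrArg (Int.cast : ℤ → ℂ) e1
  have c2 : (δ * γ 0 1 : ℂ) = p * y + q * w := by exact_mod_cast congrArg (Int.cast : ℤ → ℂ) e2
  have c3 : (γ 1 0 : ℂ) = r * x := by exact_mod_cast congrArg (Int.cast : ℤ → ℂ) e3
  have c4 : (γ 1 1 : ℂ) = r * y + s * w := by exact_mod_cast congrArg (Int.cast : ℤ → ℂ) e4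
  have hjw : (γ 1 0 * τ + γ 1 1 : ℂ) = (r * φ τ + s) * w := by
    rw [c3, c4, hφ]; field_simp; ring
  have harg : (δ * (γ • τ : ℍ) : ℂ) = (p * φ τ + q) / (r * φ τ + s) := by
    rw [coe_smul_eq, eq_div_iff hjr, ← mul_div_assoc, div_mul_eq_mul_div, div_eq_iff hj, hjw]
    have : (p * φ τ + q) * w = δ * (γ 0 0 * τ + γ 0 1) := by
      rw [mul_add (δ : ℂ), ← mul_assoc, c1, c2, hφ]; field_simp; ring
    linear_combination -(r * φ τ + s) * this
  rw [harg, norm_eta_moebius_sq h1 (hpos τ), hjw, norm_mul, Complex.norm_natCast]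
  have := norm_ne_zero_iff.mpr hjr
  field_simp

/-- The order of vanishing of the eta quotient at the cusp `γ ∞`, up to a positive factor, where `C`
is the lower left entry of `γ`. -/
noncomputable def cuspOrder (a b c : ℕ) (C : ℤ) : ℝ :=
  Real.pi / 144 * ((Int.gcd C (24 * a : ℕ) : ℝ) ^ 2 - (Int.gcd C (24 : ℕ) : ℝ) ^ 2 +
    ((b : ℝ) - a) * ((Int.gcd C (24 * (a * c) : ℕ) : ℝ) ^ 2 / (a * c)))

lemma tendsto_norm_slash_F {a b c k : ℕ} (ha : a ≠ 0) (hc : c ≠ 0) (hb : b = 2 * k + 1)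
    (γ : SL(2, ℤ)) : ∃ K : ℝ, 0 < K ∧
    Tendsto (fun τ : ℍ ↦ ‖(F a b c ∣[(k : ℤ)] γ) τ‖ ^ 2 *
      Real.exp (cuspOrder a b c (γ 1 0) * τ.im)) atImInfty (𝓝 K) := by
  have hac : a * c ≠ 0 := mul_ne_zero ha hc
  have hdet : γ 0 0 * γ 1 1 - γ 0 1 * γ 1 0 = 1 := by
    have := Matrix.SpecialLinearGroup.det_coe γ
    rwa [Matrix.det_fin_two] at this
  obtain ⟨K₁, hK₁, h₁⟩ := tendsto_norm_eta_smul γ (δ := 24 * a) (by positivity)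
  obtain ⟨K₂, hK₂, h₂⟩ := tendsto_norm_eta_smul γ (δ := 24 * (a * c)) (by positivity)
  obtain ⟨K₃, hK₃, h₃⟩ := tendsto_norm_eta_smul γ (δ := 24) (by norm_num)
  refine ⟨K₁ ^ a * K₂ ^ ((b : ℤ) - a) / K₃, by positivity, ?_⟩
  refine (((h₁.pow a).mul (h₂.zpow₀ ((b : ℤ) - a) (.inl hK₂.ne'))).div h₃ hK₃.ne').congr fun τ ↦ ?_
  have hj : (γ 1 0 * τ + γ 1 1 : ℂ) ≠ 0 := denom_ne_zero_of_det hdet τ.im_pos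
  have hJ := norm_ne_zero_iff.mpr hj
  have n3 : ‖ModularForm.eta ((24 : ℕ) * (γ • τ : ℍ))‖ ≠ 0 := norm_ne_zero_iff.mpr
    (ModularForm.eta_ne_zero (im_natCast_mul_pos (γ • τ).im_pos (by norm_num)))
  simp only [Pi.div_apply]
  rw [slash_apply_eq, F]
  rw [show (24 * (a : ℂ) * c * (γ • τ : ℍ) : ℂ) = ((24 * (a * c) : ℕ) : ℂ) * (γ • τ : ℍ) by
      push_cast; ring,
    show (24 * (a : ℂ) * (γ • τ : ℍ) : ℂ) = ((24 * a : ℕ) : ℂ) * (γ • τ : ℍ) by push_cast; ring,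
    show (24 * (γ • τ : ℍ) : ℂ) = ((24 : ℕ) : ℂ) * (γ • τ : ℍ) by push_cast; ring]
  simp only [norm_mul, norm_div, norm_pow, norm_zpow]
  generalize ‖ModularForm.eta (((24 * (a * c) : ℕ) : ℂ) * (γ • τ : ℍ))‖ = X
  generalize ‖ModularForm.eta (((24 * a : ℕ) : ℂ) * (γ • τ : ℍ))‖ = Y
  generalize ‖ModularForm.eta (((24 : ℕ) : ℂ) * (γ • τ : ℍ))‖ = Z at *
  generalize ‖(γ 1 0 * τ + γ 1 1 : ℂ)‖ = J at *
  have hE : Real.exp (cuspOrder a b c (γ 1 0) * τ.im) =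
      Real.exp (Real.pi * ((Int.gcd (γ 1 0) (24 * a : ℕ) : ℝ) ^ 2 / (24 * a : ℕ)) / 6 * τ.im) ^ a *
      Real.exp (Real.pi * ((Int.gcd (γ 1 0) (24 * (a * c) : ℕ) : ℝ) ^ 2 / (24 * (a * c) : ℕ)) / 6 *
        τ.im) ^ ((b : ℤ) - a) /
      Real.exp (Real.pi * ((Int.gcd (γ 1 0) (24 : ℕ) : ℝ) ^ 2 / (24 : ℕ)) / 6 * τ.im) := by
    rw [← Real.exp_nat_mul, ← Real.rpow_intCast, ← Real.exp_mul, ← Real.exp_add, ← Real.exp_sub, cuspOrder]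
    congr 1
    have h1 : (a : ℝ) ≠ 0 := by exact_mod_cast ha
    have h2 : (c : ℝ) ≠ 0 := by exact_mod_cast hc
    push_cast
    field_simp
    ring
  rw [hE]
  -- the automorphy factors cancel because the weights add up to `a + (b - a) - 1 = 2 k`
  have hw : (J ^ a * J ^ ((b : ℤ) - a) / J) = J ^ (2 * (k : ℤ)) := by
    rw [← zpow_natCast, ← zpow_add₀ hJ, add_sub_cancel, div_eq_mul_inv, ← zpow_neg_one,
      ← zpow_add₀ hJ, hb]
    congr 1
    push_cast
    ring
  have hw2 : (J ^ (-(k : ℤ))) ^ 2 = (J ^ (2 * (k : ℤ)))⁻¹ := by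
    rw [← zpow_natCast, ← zpow_mul, ← zpow_neg]
    congr 1
    push_cast
    ring
  simp only [mul_pow, div_pow, mul_zpow, div_zpow, hw2, ← hw]
  have hsq : (X ^ ((b : ℤ) - a)) ^ 2 = (X ^ 2) ^ ((b : ℤ) - a) := by
    rw [← zpow_natCast, ← zpow_natCast X 2, ← zpow_mul, ← zpow_mul, mul_comm]
  rw [hsq, pow_right_comm Y a 2]
  have e3 := (Real.exp_pos (Real.pi * ((Int.gcd (γ 1 0) (24 : ℕ) : ℝ) ^ 2 / (24 : ℕ)) / 6 * τ.im)).ne'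
  generalize Real.exp (Real.pi * ((Int.gcd (γ 1 0) (24 : ℕ) : ℝ) ^ 2 / (24 : ℕ)) / 6 * τ.im) = E at *
  generalize Real.exp (Real.pi * ((Int.gcd (γ 1 0) (24 * a : ℕ) : ℝ) ^ 2 / (24 * a : ℕ)) / 6 *
    τ.im) = E'
  generalize Real.exp (Real.pi * ((Int.gcd (γ 1 0) (24 * (a * c) : ℕ) : ℝ) ^ 2 /
    (24 * (a * c) : ℕ)) / 6 * τ.im) = E''
  field_simp

lemma mdifferentiable_slash {f : ℍ → ℂ} (hf : MDiff f) (k : ℤ) (γ : SL(2, ℤ)) : MDiff (f ∣[k] γ) :=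
  hf.slash k (γ : GL (Fin 2) ℝ)

/-- A function with a Nebentypus modulo `N` has period `N` at every cusp. -/
lemma IsHolomorphicNebentypus.slash_add_period {N : ℕ} {k : ℤ} {χ : DirichletCharacter ℂ N}
    {f : ℍ → ℂ} (hf : IsHolomorphicNebentypus N k χ f) (γ : SL(2, ℤ)) :
    (f ∣[k] γ) ∣[k] (ModularGroup.T ^ (N : ℤ)) = f ∣[k] γ := by
  have hT : ModularGroup.T ^ (N : ℤ) ∈ Gamma N := by
    simpa using ModularGroup_T_pow_mem_Gamma N N dvd_rfl
  have hconj : γ * ModularGroup.T ^ (N : ℤ) * γ⁻¹ ∈ Gamma N := (Gamma_normal N).conj_mem _ hT γ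
  obtain ⟨-, -, h10, h11⟩ := Gamma_mem.mp hconj
  have h := hf.slash _ (Gamma0_mem.mpr h10)
  rw [h11, map_one, one_smul] at h
  rw [← SlashAction.slash_mul]
  conv_rhs => rw [← h]
  rw [← SlashAction.slash_mul, inv_mul_cancel_right]

lemma IsHolomorphicNebentypus.periodic {N : ℕ} {k : ℤ} {χ : DirichletCharacter ℂ N}
    {f : ℍ → ℂ} (hf : IsHolomorphicNebentypus N k χ f) (γ : SL(2, ℤ)) :
    Function.Periodic ((f ∣[k] γ) ∘ ofComplex) (N : ℝ) := by
  intro w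
  by_cases hw : 0 < w.im
  · have hw' : 0 < (w + (N : ℝ)).im := by simpa using hw
    simp only [Function.comp_apply, ofComplex_apply_of_im_pos hw, ofComplex_apply_of_im_pos hw']
    have h := congrFun (hf.slash_add_period γ) ⟨w, hw⟩
    rw [slash_apply_eq, ModularGroup.coe_T_zpow] at h
    simp only [Matrix.of_apply, Matrix.cons_val', Matrix.cons_val_zero, Matrix.cons_val_one,
      Matrix.cons_val_fin_one, Int.cast_zero, zero_mul, zero_add, Int.cast_one, one_zpow,
      mul_one] at h
    rw [← h]
    exact congrArg _ (UpperHalfPlane.ext (by rw [ModularGroup.coe_T_zpow_smul_eq]; simp))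
  · have hw' : (w + (N : ℝ)).im ≤ 0 := by simpa using hw
    simp only [Function.comp_apply, ofComplex_apply_of_im_nonpos (not_lt.mp hw),
      ofComplex_apply_of_im_nonpos hw']

/-- A holomorphic function of period `N` of at most exponential growth in `Im τ` is meromorphic at
infinity: multiplication by a power of the local parameter makes it bounded. -/
lemma isMeromorphicAtImInfty_of_growth {f : ℍ → ℂ} (hf : MDiff f) {N : ℕ} (hN : 0 < N)
    (hp : Function.Periodic (f ∘ ofComplex) (N : ℝ)) {E K : ℝ}
    (hK : Tendsto (fun τ : ℍ ↦ ‖f τ‖ ^ 2 * Real.exp (E * τ.im)) atImInfty (𝓝 K)) :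
    IsMeromorphicAtImInfty f := by
  have hNR : (0 : ℝ) < N := by exact_mod_cast hN
  obtain ⟨M, hM⟩ := exists_nat_ge (-(E * N) / (4 * Real.pi))
  set q : ℂ → ℂ := Function.Periodic.qParam (N : ℝ) with hq
  set g : ℍ → ℂ := fun τ ↦ q τ ^ M * f τ with hg
  have hq1 : ∀ z : ℂ, q (z + (N : ℝ)) = q z := fun z ↦ by
    have hNC : (N : ℂ) ≠ 0 := by exact_mod_cast hN.ne'
    rw [hq, Function.Periodic.qParam, Function.Periodic.qParam, Complex.ofReal_natCast, mul_add,
      add_div, mul_div_cancel_right₀ _ hNC, Complex.exp_periodic]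
  have hgp : Function.Periodic (g ∘ ofComplex) (N : ℝ) := fun w ↦ by
    have h := hp w
    by_cases hw : 0 < w.im
    · have hw' : 0 < (w + (N : ℝ)).im := by simpa using hw
      simp only [Function.comp_apply, ofComplex_apply_of_im_pos hw, ofComplex_apply_of_im_pos hw',
        hg] at h ⊢
      rw [h, hq1]
    · have hw' : (w + (N : ℝ)).im ≤ 0 := by simpa using hw
      simp only [Function.comp_apply, ofComplex_apply_of_im_nonpos (not_lt.mp hw),
        ofComplex_apply_of_im_nonpos hw']
  have hgd : MDiff g := by
    rw [UpperHalfPlane.mdifferentiable_iff] at hf ⊢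
    have : DifferentiableOn ℂ (fun z ↦ q z ^ M * (f ∘ ofComplex) z) {z | 0 < z.im} :=
      ((Function.Periodic.differentiable_qParam.pow M).differentiableOn).mul hf
    refine this.congr fun z hz ↦ ?_
    simp only [Function.comp_apply, hg, ofComplex_apply_of_im_pos hz]
  have hgb : IsBoundedAtImInfty g := by
    rw [isBoundedAtImInfty_iff]
    have hev := (hK.eventually_le_const (lt_add_one K)).and
      (tendsto_im_atImInfty.eventually_ge_atTop 0)
    obtain ⟨A, hA⟩ := (atImInfty_mem _).mp hev
    refine ⟨K + 2, A, fun τ hτ ↦ ?_⟩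
    obtain ⟨h1, h2⟩ := hA τ hτ
    have hK0 : 0 ≤ K + 1 := le_trans (by positivity) h1
    have hle : ‖g τ‖ ^ 2 ≤ ‖f τ‖ ^ 2 * Real.exp (E * τ.im) := by
      rw [hg, norm_mul, norm_pow, mul_pow, mul_comm, hq, Function.Periodic.norm_qParam, ← pow_mul,
        ← Real.exp_nat_mul]
      refine mul_le_mul_of_nonneg_left (Real.exp_le_exp.mpr ?_) (by positivity)
      rw [div_le_iff₀ (by positivity)] at hM
      have : -E ≤ 4 * Real.pi * M / N := by
        rw [le_div_iff₀ hNR]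
        linarith
      have h5 := mul_le_mul_of_nonneg_right this h2
      push_cast
      rw [coe_im, show (M : ℝ) * 2 * (-2 * Real.pi * τ.im / N) = -(4 * Real.pi * M / N * τ.im) by
        ring]
      linarith
    nlinarith [norm_nonneg (g τ)]
  refine ⟨N, hN, -M, fun n ↦ (qExpansion (N : ℝ) g).coeff n, fun τ ↦ ?_⟩
  have h := (hasSum_qExpansion hNR hgp hgd hgb τ).mul_left ((q τ ^ M)⁻¹)
  have hq0 : q τ ≠ 0 := Function.Periodic.qParam_ne_zero _
  have hgτ : (q τ ^ M)⁻¹ * g τ = f τ := by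
    rw [hg]; field_simp
  rw [hgτ] at h
  refine Eq.subst (motive := fun u ↦ HasSum u (f τ)) (funext fun n ↦ ?_) h
  change _ = _ * q τ ^ (-(M : ℤ) + n)
  rw [zpow_add₀ hq0, zpow_neg, zpow_natCast, zpow_natCast, smul_eq_mul]
  ring

/-! ### The sign of the order at a cusp -/

/-- The contributions of `η(24 a τ) ^ a` and `η(24 τ)⁻¹` add up to a nonnegative order, because
`gcd(C, 24)` divides `gcd(C, 24 a)`. -/
lemma le_cuspOrder {a b c : ℕ} (ha : a ≠ 0) (C : ℤ) :
    Real.pi / 144 * (((b : ℝ) - a) * ((Int.gcd C (24 * (a * c) : ℕ) : ℝ) ^ 2 / (a * c))) ≤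
      cuspOrder a b c C := by
  have hdvd : Int.gcd C (24 : ℕ) ∣ Int.gcd C (24 * a : ℕ) :=
    Int.gcd_dvd_gcd_of_dvd_right _ (by exact_mod_cast Dvd.intro a rfl)
  have hpos : 0 < Int.gcd C (24 * a : ℕ) :=
    Int.gcd_pos_of_ne_zero_right _ (by exact_mod_cast mul_ne_zero (by norm_num) ha)
  have hle : (Int.gcd C (24 : ℕ) : ℝ) ≤ Int.gcd C (24 * a : ℕ) := by
    exact_mod_cast Nat.le_of_dvd hpos hdvd
  have hsq : (Int.gcd C (24 : ℕ) : ℝ) ^ 2 ≤ (Int.gcd C (24 * a : ℕ) : ℝ) ^ 2 := by gcongr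
  exact mul_le_mul_of_nonneg_left (le_add_of_nonneg_left (sub_nonneg.mpr hsq)) (by positivity)

lemma cuspOrder_nonneg {a b c : ℕ} (ha : a ≠ 0) (hab : a ≤ b) (C : ℤ) :
    0 ≤ cuspOrder a b c C := by
  have h : (0 : ℝ) ≤ (b : ℝ) - a := sub_nonneg.mpr (by exact_mod_cast hab)
  exact le_trans (by positivity) (le_cuspOrder ha C)

lemma cuspOrder_pos {a b c : ℕ} (ha : a ≠ 0) (hc : c ≠ 0) (hab : a < b) (C : ℤ) :
    0 < cuspOrder a b c C := by
  have h : (0 : ℝ) < (b : ℝ) - a := sub_pos.mpr (by exact_mod_cast hab)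
  have hg : 0 < Int.gcd C (24 * (a * c) : ℕ) := Int.gcd_pos_of_ne_zero_right _
    (by exact_mod_cast mul_ne_zero (by norm_num) (mul_ne_zero ha hc))
  have ha' : (0 : ℝ) < a := by exact_mod_cast Nat.pos_of_ne_zero ha
  have hc' : (0 : ℝ) < c := by exact_mod_cast Nat.pos_of_ne_zero hc
  have hg' : (0 : ℝ) < Int.gcd C (24 * (a * c) : ℕ) := by exact_mod_cast hg
  exact lt_of_lt_of_le (by positivity) (le_cuspOrder ha C)

lemma cuspOrder_one (a b c : ℕ) : cuspOrder a b c 1 = Real.pi / 144 * (((b : ℝ) - a) / (a * c)) := by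
  simp only [cuspOrder, Int.one_gcd]
  simp [div_eq_mul_inv]

/-! ### From the order at a cusp to boundedness and vanishing -/

section Growth

variable {f : ℍ → ℂ} {E K : ℝ}

lemma isBoundedAtImInfty_of_growth (hE : 0 ≤ E)
    (hK : Tendsto (fun τ : ℍ ↦ ‖f τ‖ ^ 2 * Real.exp (E * τ.im)) atImInfty (𝓝 K)) :
    IsBoundedAtImInfty f := by
  rw [isBoundedAtImInfty_iff]
  obtain ⟨A, hA⟩ := (atImInfty_mem _).mp (hK.eventually_le_const (lt_add_one K))
  refine ⟨K + 2, A, fun τ hτ ↦ ?_⟩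
  have h1 : ‖f τ‖ ^ 2 * Real.exp (E * τ.im) ≤ K + 1 := hA τ hτ
  have h2 : ‖f τ‖ ^ 2 ≤ ‖f τ‖ ^ 2 * Real.exp (E * τ.im) :=
    le_mul_of_one_le_right (by positivity) (Real.one_le_exp (mul_nonneg hE τ.im_pos.le))
  nlinarith [norm_nonneg (f τ)]

lemma isZeroAtImInfty_of_growth (hE : 0 < E)
    (hK : Tendsto (fun τ : ℍ ↦ ‖f τ‖ ^ 2 * Real.exp (E * τ.im)) atImInfty (𝓝 K)) :
    IsZeroAtImInfty f := by
  have h0 : Tendsto (fun τ : ℍ ↦ Real.exp (-(E * τ.im))) atImInfty (𝓝 0) :=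
    Real.tendsto_exp_neg_atTop_nhds_zero.comp (tendsto_im_atImInfty.const_mul_atTop hE)
  have h : Tendsto (fun τ : ℍ ↦ ‖f τ‖ ^ 2) atImInfty (𝓝 0) := by
    have := hK.mul h0
    rw [mul_zero] at this
    refine this.congr fun τ ↦ ?_
    rw [mul_assoc, ← Real.exp_add, add_neg_cancel, Real.exp_zero, mul_one]
  have h' := h.sqrt
  rw [Real.sqrt_zero] at h'
  exact tendsto_zero_iff_norm_tendsto_zero.mpr (h'.congr fun τ ↦ Real.sqrt_sq (norm_nonneg _))

lemma not_isBoundedAtImInfty_of_growth (hE : E < 0) (hK0 : 0 < K)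
    (hK : Tendsto (fun τ : ℍ ↦ ‖f τ‖ ^ 2 * Real.exp (E * τ.im)) atImInfty (𝓝 K)) :
    ¬ IsBoundedAtImInfty f := by
  intro hb
  obtain ⟨M, A, hM⟩ := isBoundedAtImInfty_iff.mp hb
  have h0 : Tendsto (fun τ : ℍ ↦ M ^ 2 * Real.exp (E * τ.im)) atImInfty (𝓝 0) := by
    have := (Real.tendsto_exp_atBot.comp
      (tendsto_im_atImInfty.const_mul_atTop_of_neg hE)).const_mul (M ^ 2)
    rwa [mul_zero] at this
  refine hK0.not_ge (le_of_tendsto_of_tendsto hK h0 ?_)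
  refine (atImInfty_mem _).mpr ⟨A, fun τ hτ ↦ ?_⟩
  have := hM τ hτ
  change ‖f τ‖ ^ 2 * Real.exp (E * τ.im) ≤ M ^ 2 * Real.exp (E * τ.im)
  gcongr

lemma not_isZeroAtImInfty_of_growth (hE : E ≤ 0) (hK0 : 0 < K)
    (hK : Tendsto (fun τ : ℍ ↦ ‖f τ‖ ^ 2 * Real.exp (E * τ.im)) atImInfty (𝓝 K)) :
    ¬ IsZeroAtImInfty f := by
  intro hz
  have h0 : Tendsto (fun τ : ℍ ↦ ‖f τ‖ ^ 2) atImInfty (𝓝 0) := by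
    have := (tendsto_zero_iff_norm_tendsto_zero.mp hz).pow 2
    simpa using this
  refine hK0.not_ge (le_of_tendsto_of_tendsto' hK h0 fun τ ↦ ?_)
  exact mul_le_of_le_one_right (by positivity)
    (Real.exp_le_one_iff.mpr (mul_nonpos_of_nonpos_of_nonneg hE τ.im_pos.le))

end Growth

end EtaQuotient

theorem mainTheorem5 (a b c k : ℕ) (ha : 1 ≤ a) (hc : 1 ≤ c)
    (hb : Odd b) (hk : (k : ℚ) = ((b : ℚ) - 1) / 2) :
    ∃ χ : DirichletCharacter ℂ (576 * a * c),
      (∀ d : ℤ, IsCoprime d ((576 * a * c : ℕ) : ℤ) →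
        χ (d : ZMod (576 * a * c)) =
          ((EtaQuotient.kroneckerSym
            (if Even a then (-1) ^ k * ((a : ℤ) * (c : ℤ)) else (-1) ^ k * (a : ℤ)) d : ℤ) : ℂ)) ∧
      EtaQuotient.IsWeaklyHolomorphicForm (576 * a * c) (k : ℤ) χ (EtaQuotient.F a b c) ∧
      (EtaQuotient.IsHolomorphicForm (576 * a * c) (k : ℤ) χ (EtaQuotient.F a b c) ↔ a ≤ b) ∧
      (EtaQuotient.IsCuspidalForm (576 * a * c) (k : ℤ) χ (EtaQuotient.F a b c) ↔ a < b) := by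
  have ha0 : a ≠ 0 := Nat.one_le_iff_ne_zero.mp ha
  have hc0 : c ≠ 0 := Nat.one_le_iff_ne_zero.mp hc
  have hbk : b = 2 * k + 1 := by
    have : (b : ℚ) = 2 * k + 1 := by rw [hk]; ring
    exact_mod_cast this
  have haR : (0 : ℝ) < a := by exact_mod_cast ha
  have hcR : (0 : ℝ) < c := by exact_mod_cast hc
  obtain ⟨χ, hχ, hF⟩ := EtaQuotient.isHolomorphicNebentypus_F ha0 hc0 hbk
  have growth := EtaQuotient.tendsto_norm_slash_F ha0 hc0 hbk
  -- the cusp `0 = S ∞` decides the converse directions: there the order has the sign of `b - a`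
  have hS : ModularGroup.S 1 0 = 1 := by simp [ModularGroup.S]
  obtain ⟨K, hK0, hK⟩ := growth ModularGroup.S
  rw [hS, EtaQuotient.cuspOrder_one] at hK
  refine ⟨χ, hχ, ⟨hF, fun γ ↦ ?_⟩, ⟨fun h ↦ ?_, fun hab ↦ ⟨hF, fun γ ↦ ?_⟩⟩,
    ⟨fun h ↦ ?_, fun hab ↦ ⟨hF, fun γ ↦ ?_⟩⟩⟩
  · obtain ⟨K', -, hK'⟩ := growth γ
    exact EtaQuotient.isMeromorphicAtImInfty_of_growth (EtaQuotient.mdifferentiable_slash hF.holo _ γ)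
      (by positivity) (hF.periodic γ) hK'
  · by_contra! hlt
    refine EtaQuotient.not_isBoundedAtImInfty_of_growth ?_ hK0 hK (h.bounded_at_cusps _)
    have : (b : ℝ) - a < 0 := sub_neg.mpr (by exact_mod_cast hlt)
    exact mul_neg_of_pos_of_neg (by positivity) (div_neg_of_neg_of_pos this (by positivity))
  · obtain ⟨K', -, hK'⟩ := growth γ
    exact EtaQuotient.isBoundedAtImInfty_of_growth (EtaQuotient.cuspOrder_nonneg ha0 hab _) hK'
  · by_contra! hle
    refine EtaQuotient.not_isZeroAtImInfty_of_growth ?_ hK0 hK (h.zero_at_cusps _)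
    have : (b : ℝ) - a ≤ 0 := sub_nonpos.mpr (by exact_mod_cast hle)
    exact mul_nonpos_of_nonneg_of_nonpos (by positivity)
      (div_nonpos_of_nonpos_of_nonneg this (by positivity))
  · obtain ⟨K', -, hK'⟩ := growth γ
    exact EtaQuotient.isZeroAtImInfty_of_growth (EtaQuotient.cuspOrder_pos ha0 hc0 hab _) hK'
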